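/- Let $\beta\in(0,2)\setminus\{1\}$ and let $(X_j)_{j\ge 1}$ be i.i.d. non-negative random variables whose common tail $\bar F(x)=\mathbb P[X_1>x]$ is regularly varying of index $-\beta$, i.e. $\bar F(\Lambda x)/\bar F(x)\to\Lambda^{-\beta}$ as $x\to\infty$ for every $\Lambda>0$. Assume moreover that the $X_j$ lie in the normal domain of attraction of a spectrally positive $\beta$-stable law: there are constants $a_n\in\mathbb R$ such that $n^{-1/\beta}\bigl(\sum_{j=1}^n X_j-a_n\bigr)$ converges in distribution to a law with characteristic function $$t\mapsto \exp\Bigl(i\delta t-\sigma^\beta|t|^\beta\bigl(1-i\,\mathrm{sgn}(t)\tan\tfrac{\pi\beta}{2}\bigr)\Bigr)$$ for some $\sigma>0$ and $\delta\in\mathbb R$. Let $(m_i)_{i\ge0}$ be a memory kernel with $m_0=1$ and $m_i>0$ for all $i$, and put $$Y_k=\sum_{j=1}^k m_{k-j}X_j,\qquad S_n=\sum_{k=1}^n Y_k,\qquad L_n=\sum_{k=1}^n\Bigl(\sum_{i=0}^{n-k}m_i\Bigr)^{\beta},$$ with $b_n=0$ if $\beta\in(0,1)$ and $b_n=\mathbb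 E[S_n]$ if $\beta\in(1,2)$. Then, for every real sequence $(x_n)$ with $x_n\to\infty$ and $L_n\,\mathbb P[X_1>x_n]\to0$ as $n\to\infty$, $$\lim_{n\to\infty}\ \sup_{x\ge x_n}\left|\frac{\mathbb P[S_n-b_n>x]}{L_n\,\mathbb P[X_1>x]}-1\right|=0 .$$ This covers long-memory kernels for which $L_n$ grows superlinearly: for $m_k=(k+1)^{-\nu}$ with $0<\nu<1$, there is a constant $c>0$ such that $L_n/n^{1+\beta(1-\nu)}\to c$ as $n\to\infty$. -/

import Mathlib

open MeasureTheory ProbabilityTheory Filter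
open scoped Topology

noncomputable section

namespace MemoryWalk

/-- The law of a real random variable has a regularly varying right tail of index `-β`:
`P[X > Λ x] / P[X > x] → Λ ^ (-β)` as `x → ∞`, for every `Λ > 0`. -/
def RegularlyVaryingTail {Ω : Type*} [MeasurableSpace Ω] (P : Measure Ω) (X : Ω → ℝ)
    (β : ℝ) : Prop :=
  ∀ Λ : ℝ, 0 < Λ →
    Tendsto (fun x : ℝ => P.real {ω | Λ * x < X ω} / P.real {ω | x < X ω}) atTop
      (𝓝 (Λ ^ (-β)))

/-- `ν` is a (non-degenerate) spectrally positive, i.e. totally right-skewed, `β`-stable law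
with `β ∈ (0,2) \ {1}`: for some scale `σ > 0` and location `δ`, its characteristic function is
`t ↦ exp (i δ t - σ ^ β |t| ^ β (1 - i sgn(t) tan (π β / 2)))`. -/
def IsSpectrallyPositiveStable (β : ℝ) (ν : Measure ℝ) : Prop :=
  ∃ σ δ : ℝ, 0 < σ ∧ ∀ t : ℝ,
    charFun ν t =
      Complex.exp (Complex.I * ((δ * t : ℝ) : ℂ) -
        ((σ ^ β * |t| ^ β : ℝ) : ℂ) *
          (1 - Complex.I * ((SignType.sign t * Real.tan (Real.pi * β / 2) : ℝ) : ℂ)))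

/-- The i.i.d. sequence `X` is in the normal domain of attraction of a spectrally positive
`β`-stable law: with the pure power norming `n ^ (1 / β)` and some centering constants `a n`,
the normalized sums `(X 0 + ⋯ + X (n - 1) - a n) / n ^ (1 / β)` converge in distribution to such
a law. (A constant factor in the norming is absorbed in the scale of the limit.) -/
def InNormalDomainOfAttraction {Ω : Type*} [MeasurableSpace Ω] (P : Measure Ω)
    [IsProbabilityMeasure P] (X : ℕ → Ω → ℝ) (β : ℝ) : Prop :=
  ∃ ν : ProbabilityMeasure ℝ, IsSpectrallyPositiveStable β (ν : Measure ℝ) ∧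
    ∃ a : ℕ → ℝ,
      TendstoInDistribution
        (fun (n : ℕ) (ω : Ω) => ((∑ k ∈ Finset.range n, X k ω) - a n) / (n : ℝ) ^ (1 / β))
        atTop (id : ℝ → ℝ) (fun _ => P) (ν : Measure ℝ)

/-- The correlated increments. The innovations are indexed from `0`, so that `X j` is the
`(j + 1)`-st innovation and `increment m X k` is the `(k + 1)`-st increment. -/
def increment {Ω : Type*} (m : ℕ → ℝ) (X : ℕ → Ω → ℝ) (k : ℕ) (ω : Ω) : ℝ :=
  ∑ j ∈ Finset.range (k + 1), m (k - j) * X j ω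

/-- `S_n`, the sum of the first `n` correlated increments. -/
def partialSum {Ω : Type*} (m : ℕ → ℝ) (X : ℕ → Ω → ℝ) (n : ℕ) (ω : Ω) : ℝ :=
  ∑ k ∈ Finset.range n, increment m X k ω

/-- The centering `b_n`: zero if `β < 1`, and the mean of `S_n` otherwise. -/
def centering {Ω : Type*} [MeasurableSpace Ω] (P : Measure Ω) (m : ℕ → ℝ) (X : ℕ → Ω → ℝ)
    (β : ℝ) (n : ℕ) : ℝ :=
  if β < 1 then 0 else ∫ ω, partialSum m X n ω ∂P

/-- `L_n = ∑_{k=1}^n (∑_{i=0}^{n-k} m_i) ^ β`. -/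
def scale (m : ℕ → ℝ) (β : ℝ) (n : ℕ) : ℝ :=
  ∑ k ∈ Finset.Icc 1 n, (∑ i ∈ Finset.range (n - k + 1), m i) ^ β

end MemoryWalk

end

noncomputable section

namespace MemoryWalk

/-! Exchanging the two summations writes `S_n` as a sum of independent terms `w_j X_j`, where `w_j`
is a partial sum of the kernel, and `L_n = ∑ w_j ^ β` (`partialSum_eq_weighted_sum`,
`scale_eq_sum_range`). The kernel enters only through these positive weights, so it suffices to have
an estimate uniform over all finite weight families.

The two tail hypotheses together force a pure power tail, `x ^ β F(x) → c > 0`. Moduli of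
characteristic functions remove the centering and the skewness, and convergence to the stable law
reads `‖φ(n ^ (-1/β))‖ ^ n → exp (-τ)`. Regular variation gives `1 - ‖φ(1/x)‖ ^ 2 ~ 2 r F(x)` for
some `r > 0`, hence `n F(n ^ (1/β)) → τ / r`. Monotonicity of `F` fills the gaps
(`exists_tendsto_rpow_mul_tail`).

The core is `weighted_sum_large_deviation`: with `V = ∑ v_i ^ β`, the centered sum `∑ v_i X_i`
exceeds `1` with probability `(c + o(1)) V` as `V → 0`, uniformly in the weights. One summand makes
the jump; two summands above a fixed level cost `O(V ^ 2)`, and the truncated rest is controlled by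
Chebyshev, where bias and variance are both of order `V`.

Taking `v = w / x` gives `V = L_n / x ^ β`. Since `F(x) ~ c x ^ (-β)`, the condition `L_n F(x_n) →
0` says that `V` is small at `x_n`, hence at every `x ≥ x_n`, while `L_n F(x) ~ c V`. This is the
uniform statement. The algebraic kernel is handled by Stolz–Cesàro summation, used twice. -/

/-- The right tail of a law on the real line is regularly varying of index `-β`. -/
def RegularlyVaryingLaw (μ : Measure ℝ) (β : ℝ) : Prop :=
  ∀ Λ : ℝ, 0 < Λ →
    Tendsto (fun x : ℝ => μ.real (Set.Ioi (Λ * x)) / μ.real (Set.Ioi x)) atTop (𝓝 (Λ ^ (-β)))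

/-! ### Regular variation: Potter bound and truncated integrals -/

section Law

variable {μ : Measure ℝ} [IsProbabilityMeasure μ] {β : ℝ}

lemma antitone_tail : Antitone fun x : ℝ => μ.real (Set.Ioi x) := fun _ _ h =>
  measureReal_mono (Set.Ioi_subset_Ioi h)

/-- Were the tail zero at some large `y`, the quotient there would be `0` by the convention for
division by zero, against its nonzero limit. -/
lemma RegularlyVaryingLaw.tail_pos (h : RegularlyVaryingLaw μ β) (x : ℝ) :
    0 < μ.real (Set.Ioi x) := by
  have h2 := (h 2 two_pos).eventually_ne (Real.rpow_pos_of_pos two_pos (-β)).ne'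
  obtain ⟨y, hy, hxy⟩ := (h2.and (eventually_ge_atTop x)).exists
  have : μ.real (Set.Ioi y) ≠ 0 := fun h0 => hy (by simp [h0])
  exact lt_of_lt_of_le (lt_of_le_of_ne measureReal_nonneg this.symm) (antitone_tail hxy)

/-- A one-sided Potter bound. -/
lemma RegularlyVaryingLaw.potter (h : RegularlyVaryingLaw μ β) {γ : ℝ} (hγ : β < γ)
    (hγ0 : 0 < γ) :
    ∃ C > 0, ∃ x₀ > 0, ∀ x ≥ x₀, ∀ y, 0 < y → y ≤ x →
      y ^ γ * μ.real (Set.Ioi y) ≤ C * (x ^ γ * μ.real (Set.Ioi x)) := by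
  have hlt : (2 : ℝ) ^ (-γ) < 2 ^ (-β) :=
    Real.rpow_lt_rpow_of_exponent_lt one_lt_two (by linarith)
  -- Since `γ > β`, the limit ratio strictly exceeds `2 ^ (-γ)`; so `x ^ γ F(x)` eventually does not
  -- decrease when `x` doubles.
  obtain ⟨x₁, hx₁⟩ := eventually_atTop.1 ((h 2 two_pos).eventually (lt_mem_nhds hlt))
  set a := max x₁ 1 with ha
  have ha0 : 0 < a := lt_of_lt_of_le one_pos (le_max_right _ _)
  have hstep : ∀ x ≥ a, x ^ γ * μ.real (Set.Ioi x) ≤ (2 * x) ^ γ * μ.real (Set.Ioi (2 * x)) := by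
    intro x hx
    have hx0 : 0 < x := ha0.trans_le hx
    have h1 := hx₁ x ((le_max_left _ _).trans hx)
    rw [lt_div_iff₀ (h.tail_pos x), Real.rpow_neg two_pos.le] at h1
    rw [Real.mul_rpow two_pos.le hx0.le]
    have h2 : (0 : ℝ) < 2 ^ γ := Real.rpow_pos_of_pos two_pos γ
    have h3 : μ.real (Set.Ioi x) ≤ 2 ^ γ * μ.real (Set.Ioi (2 * x)) := by
      rw [inv_mul_eq_div, div_lt_iff₀ h2] at h1
      linarith
    calc x ^ γ * μ.real (Set.Ioi x) ≤ x ^ γ * (2 ^ γ * μ.real (Set.Ioi (2 * x))) :=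
          mul_le_mul_of_nonneg_left h3 (Real.rpow_nonneg hx0.le _)
      _ = _ := by ring
  have hiter : ∀ (k : ℕ) (x : ℝ), a ≤ x → x ^ γ * μ.real (Set.Ioi x) ≤
      (2 ^ k * x) ^ γ * μ.real (Set.Ioi (2 ^ k * x)) := by
    intro k
    induction k with
    | zero => intro x _; simp
    | succ k ih =>
      intro x hx
      have hx0 : 0 < x := ha0.trans_le hx
      have : a ≤ 2 ^ k * x := hx.trans (le_mul_of_one_le_left hx0.le (one_le_pow₀ one_le_two))
      have h4 := (ih x hx).trans (hstep _ this)
      rwa [← mul_assoc, ← pow_succ'] at h4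
  have hmain : ∀ x y, a ≤ y → y ≤ x →
      y ^ γ * μ.real (Set.Ioi y) ≤ 2 ^ γ * (x ^ γ * μ.real (Set.Ioi x)) := by
    intro x y hy hxy
    have hy0 : 0 < y := ha0.trans_le hy
    obtain ⟨k, hk1, hk2⟩ := exists_nat_pow_near ((one_le_div hy0).2 hxy) one_lt_two
    rw [le_div_iff₀ hy0] at hk1
    rw [div_lt_iff₀ hy0] at hk2
    refine (hiter (k + 1) y hy).trans ?_
    rw [← mul_assoc, ← Real.mul_rpow two_pos.le (hy0.le.trans hxy)]
    refine mul_le_mul (Real.rpow_le_rpow (by positivity) ?_ hγ0.le) (antitone_tail hk2.le)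
      measureReal_nonneg (Real.rpow_nonneg (by linarith) _)
    rw [pow_succ]
    linarith
  have hFa : 0 < a ^ γ * μ.real (Set.Ioi a) := mul_pos (Real.rpow_pos_of_pos ha0 γ) (h.tail_pos a)
  have h2 : (0 : ℝ) < 2 ^ γ := Real.rpow_pos_of_pos two_pos γ
  -- The first summand serves `y ≥ a`. For `y < a` only `F ≤ 1` is used, and the second summand pays
  -- by comparing `x` with the base point `a`.
  refine ⟨2 ^ γ + a ^ γ * (2 ^ γ / (a ^ γ * μ.real (Set.Ioi a))), by positivity, a, ha0, ?_⟩
  intro x hx y hy hyx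
  have hx0 : 0 < x := ha0.trans_le hx
  have hFx : 0 < x ^ γ * μ.real (Set.Ioi x) :=
    mul_pos (Real.rpow_pos_of_pos hx0 γ) (h.tail_pos x)
  rcases le_total a y with hay | hya
  · refine (hmain x y hay hyx).trans ?_
    rw [add_mul]
    exact le_add_of_nonneg_right (by positivity)
  · have h5 := hmain x a le_rfl hx
    have h6 : y ^ γ * μ.real (Set.Ioi y) ≤ a ^ γ * 1 :=
      mul_le_mul (Real.rpow_le_rpow hy.le hya hγ0.le) measureReal_le_one measureReal_nonneg
        (by positivity)
    have h7 : 1 ≤ 2 ^ γ / (a ^ γ * μ.real (Set.Ioi a)) * (x ^ γ * μ.real (Set.Ioi x)) := by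
      rw [div_mul_eq_mul_div, one_le_div hFa]
      exact h5
    calc y ^ γ * μ.real (Set.Ioi y) ≤ a ^ γ * 1 := h6
      _ ≤ a ^ γ * (2 ^ γ / (a ^ γ * μ.real (Set.Ioi a)) * (x ^ γ * μ.real (Set.Ioi x))) := by gcongr
      _ ≤ _ := by
        rw [add_mul, mul_assoc (a ^ γ)]
        exact le_add_of_nonneg_left (by positivity)

lemma RegularlyVaryingLaw.tendsto_rpow_mul_tail (h : RegularlyVaryingLaw μ β) {ρ : ℝ}
    (hβ0 : 0 < β) (hρ : β < ρ) :
    Tendsto (fun x : ℝ => x ^ ρ * μ.real (Set.Ioi x)) atTop atTop := by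
  obtain ⟨γ, h1, h2⟩ := exists_between hρ
  obtain ⟨C, hC, x₀, hx₀, hp⟩ := h.potter h1 (hβ0.trans h1)
  have hpos : 0 < x₀ ^ γ * μ.real (Set.Ioi x₀) / C :=
    div_pos (mul_pos (Real.rpow_pos_of_pos hx₀ γ) (h.tail_pos x₀)) hC
  refine tendsto_atTop_mono' _ ?_ ((tendsto_rpow_atTop (sub_pos.2 h2)).atTop_mul_const hpos)
  filter_upwards [eventually_ge_atTop x₀] with x hx
  have hx0 : 0 < x := hx₀.trans_le hx
  have h3 := hp x hx x₀ hx₀ hx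
  have : x ^ ρ = x ^ (ρ - γ) * x ^ γ := by rw [← Real.rpow_add hx0]; ring_nf
  rw [this, mul_assoc]
  refine mul_le_mul_of_nonneg_left ?_ (Real.rpow_nonneg hx0.le _)
  rw [div_le_iff₀ hC]
  linarith

lemma measurable_tail_comp (x : ℝ) : Measurable fun u : ℝ => μ.real (Set.Ioi (u * x)) := by
  rcases le_total 0 x with hx | hx
  · have : Antitone fun u : ℝ => μ.real (Set.Ioi (u * x)) := fun _ _ h =>
      antitone_tail (mul_le_mul_of_nonneg_right h hx)
    exact this.measurable
  · have : Monotone fun u : ℝ => μ.real (Set.Ioi (u * x)) := fun _ _ h =>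
      antitone_tail (mul_le_mul_of_nonpos_right h hx)
    exact this.measurable

/-- Fubini for the tail: the expectation of a primitive of `g` at the truncated variable. -/
lemma integral_primitive_min (hμ : ∀ᵐ y ∂μ, 0 ≤ y) {g : ℝ → ℝ} (hg : Continuous g) {K x : ℝ}
    (hK : 0 ≤ K) (hx : 0 < x) :
    ∫ y, (∫ u in (0 : ℝ)..(min (y / x) K), g u) ∂μ =
      ∫ u in (0 : ℝ)..K, g u * μ.real (Set.Ioi (u * x)) := by
  have hset : MeasurableSet {p : ℝ × ℝ | p.2 * x < p.1} :=
    measurableSet_lt (by fun_prop) (by fun_prop)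
  have hint : Integrable (Function.uncurry fun (y u : ℝ) =>
      {p : ℝ × ℝ | p.2 * x < p.1}.indicator (fun p => g p.2) (y, u))
      (μ.prod (volume.restrict (Set.Ioc 0 K))) := by
    have h1 : Integrable (fun p : ℝ × ℝ => g p.2) (μ.prod (volume.restrict (Set.Ioc 0 K))) :=
      ((intervalIntegrable_iff_integrableOn_Ioc_of_le hK).1
        (hg.intervalIntegrable 0 K)).integrable.comp_snd μ
    exact h1.indicator hset
  have hswap := integral_integral_swap hint
  have hL : ∀ᵐ y ∂μ, (∫ u in (0 : ℝ)..(min (y / x) K), g u) =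
      ∫ u in Set.Ioc 0 K, {p : ℝ × ℝ | p.2 * x < p.1}.indicator (fun p => g p.2) (y, u) := by
    filter_upwards [hμ] with y hy
    have h0 : 0 ≤ min (y / x) K := le_min (div_nonneg hy hx.le) hK
    -- The tail condition is the strict `u < y / x`, so open intervals make the two domains
    -- coincide.
    rw [intervalIntegral.integral_of_le h0, integral_Ioc_eq_integral_Ioo]
    have : (fun u => {p : ℝ × ℝ | p.2 * x < p.1}.indicator (fun p => g p.2) (y, u)) =
        (Set.Iio (y / x)).indicator g := by
      ext u
      simp only [Set.indicator, Set.mem_ofPred_eq, Set.mem_Iio, lt_div_iff₀ hx]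
    rw [this, integral_Ioc_eq_integral_Ioo, setIntegral_indicator measurableSet_Iio]
    congr 2
    ext u
    simp only [Set.mem_Ioo, Set.mem_inter_iff, Set.mem_Iio, lt_min_iff]
    tauto
  rw [integral_congr_ae hL, hswap, intervalIntegral.integral_of_le hK]
  refine integral_congr_ae (Eventually.of_forall fun u => ?_)
  have : (fun y => {p : ℝ × ℝ | p.2 * x < p.1}.indicator (fun p => g p.2) (y, u)) =
      (Set.Ioi (u * x)).indicator fun _ => g u := by
    ext y
    simp only [Set.indicator, Set.mem_ofPred_eq, Set.mem_Ioi]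
  beta_reduce
  rw [this, integral_indicator_const _ measurableSet_Ioi, smul_eq_mul, mul_comm]

/-- Dominated convergence: Potter bounds the ratio by `C u ^ (-γ) + 1` with `β < γ < 2`, and the
factor `g(u) = O(u)` makes this integrable at `0`. -/
lemma RegularlyVaryingLaw.tendsto_integral_truncated (h : RegularlyVaryingLaw μ β)
    (hβ0 : 0 < β) (hβ2 : β < 2) {g : ℝ → ℝ} (hg : Continuous g) {D : ℝ}
    (hgD : ∀ u, 0 ≤ u → |g u| ≤ D * u) {K : ℝ} (hK : 0 ≤ K) :
    Tendsto (fun x : ℝ => (∫ u in (0 : ℝ)..K, g u * μ.real (Set.Ioi (u * x))) /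
      μ.real (Set.Ioi x)) atTop (𝓝 (∫ u in (0 : ℝ)..K, g u * u ^ (-β))) := by
  obtain ⟨γ, h1, h2⟩ := exists_between hβ2
  have hγ0 : 0 < γ := hβ0.trans h1
  obtain ⟨C, hC, x₀, hx₀, hp⟩ := h.potter h1 hγ0
  have hrw : (fun x : ℝ => (∫ u in (0 : ℝ)..K, g u * μ.real (Set.Ioi (u * x))) /
      μ.real (Set.Ioi x)) = fun x => ∫ u in (0 : ℝ)..K,
        g u * (μ.real (Set.Ioi (u * x)) / μ.real (Set.Ioi x)) := by
    ext x
    rw [← intervalIntegral.integral_div]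
    simp only [mul_div_assoc]
  rw [hrw]
  have hD : 0 ≤ D := by simpa using (abs_nonneg _).trans (hgD 1 zero_le_one)
  refine intervalIntegral.tendsto_integral_filter_of_dominated_convergence
    (fun u => D * C * u ^ (1 - γ) + D * u) ?_ ?_ ?_ ?_
  · refine Eventually.of_forall fun x => ?_
    exact (hg.measurable.mul ((measurable_tail_comp x).div_const _)).aestronglyMeasurable
  · filter_upwards [eventually_ge_atTop x₀] with x hx
    refine Eventually.of_forall fun u hu => ?_
    rw [Set.uIoc_of_le hK] at hu
    have hu0 : 0 < u := hu.1
    have hx0 : 0 < x := hx₀.trans_le hx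
    have hF := h.tail_pos x
    rw [norm_mul, Real.norm_eq_abs, Real.norm_of_nonneg (by positivity)]
    have hb : μ.real (Set.Ioi (u * x)) / μ.real (Set.Ioi x) ≤ C * u ^ (-γ) + 1 := by
      rw [div_le_iff₀ hF]
      rcases le_total u 1 with hu1 | hu1
      · have h3 := hp x hx (u * x) (by positivity) (mul_le_of_le_one_left hx0.le hu1)
        rw [Real.mul_rpow hu0.le hx0.le] at h3
        have h4 : μ.real (Set.Ioi (u * x)) ≤ C * u ^ (-γ) * μ.real (Set.Ioi x) := by
          rw [Real.rpow_neg hu0.le]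
          have hu' : 0 < u ^ γ := Real.rpow_pos_of_pos hu0 γ
          have hx' : 0 < x ^ γ := Real.rpow_pos_of_pos hx0 γ
          rw [← div_eq_mul_inv, div_mul_eq_mul_div, le_div_iff₀ hu']
          have h5 : x ^ γ * (μ.real (Set.Ioi (u * x)) * u ^ γ) ≤
              x ^ γ * (C * μ.real (Set.Ioi x)) := by linarith
          exact le_of_mul_le_mul_left h5 hx'
        linarith
      · have h3 : μ.real (Set.Ioi (u * x)) ≤ μ.real (Set.Ioi x) :=
          antitone_tail (le_mul_of_one_le_left hx0.le hu1)
        have : 0 ≤ C * u ^ (-γ) * μ.real (Set.Ioi x) := by positivity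
        linarith
    calc |g u| * (μ.real (Set.Ioi (u * x)) / μ.real (Set.Ioi x))
        ≤ D * u * (C * u ^ (-γ) + 1) := mul_le_mul (hgD u hu0.le) hb (by positivity) (by positivity)
      _ = D * C * u ^ (1 - γ) + D * u := by
        rw [sub_eq_add_neg, Real.rpow_add hu0, Real.rpow_one]; ring
  · exact ((intervalIntegral.intervalIntegrable_rpow' (by linarith)).const_mul _).add
      (intervalIntegral.intervalIntegrable_id.const_mul _)
  · refine Eventually.of_forall fun u hu => ?_
    rw [Set.uIoc_of_le hK] at hu
    exact (h u hu.1).const_mul _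

lemma RegularlyVaryingLaw.eventually_integral_min_sq_le (h : RegularlyVaryingLaw μ β)
    (hβ0 : 0 < β) (hβ2 : β < 2) (hμ : ∀ᵐ y ∂μ, 0 ≤ y) :
    ∃ C > 0, ∀ᶠ x in atTop, ∫ y, (min (y / x) 1) ^ 2 ∂μ ≤ C * μ.real (Set.Ioi x) := by
  have h1 := h.tendsto_integral_truncated hβ0 hβ2 (g := fun u => 2 * u) (by fun_prop) (D := 2)
    (fun u hu => by rw [abs_of_nonneg (by linarith)]) zero_le_one
  set I := ∫ u in (0 : ℝ)..1, 2 * u * u ^ (-β)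
  refine ⟨|I| + 1, by positivity, ?_⟩
  filter_upwards [h1.eventually_le_const (lt_of_le_of_lt (le_abs_self I) (lt_add_one _)),
    eventually_gt_atTop 0] with x hx hx0
  rw [div_le_iff₀ (h.tail_pos x)] at hx
  refine le_of_eq_of_le ?_ hx
  rw [← integral_primitive_min hμ (by fun_prop) zero_le_one hx0]
  congr 1; ext y
  rw [intervalIntegral.integral_const_mul, integral_id]
  ring

end Law

/-! ### Behaviour of the characteristic function near zero -/

section CharFun

variable {μ : Measure ℝ} [IsProbabilityMeasure μ] {β : ℝ}

lemma integrable_of_bounded {f : ℝ → ℝ} (hf : Measurable f) {C : ℝ} (h : ∀ᵐ y ∂μ, |f y| ≤ C) :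
    Integrable f μ :=
  Integrable.of_bound hf.aestronglyMeasurable C (by simpa only [Real.norm_eq_abs] using h)

/-- The cutoff is a multiple of `2π`, where `1 - cos` vanishes. Capping `y / x` there therefore
changes the integrand only on `y > K x`, by at most `2`. -/
lemma abs_integral_one_sub_cos_sub_le (hμ : ∀ᵐ y ∂μ, 0 ≤ y) (k : ℕ) {x : ℝ} (hx : 0 < x) :
    |∫ y, (1 - Real.cos (y / x)) ∂μ -
      ∫ u in (0 : ℝ)..(k * (2 * Real.pi)), Real.sin u * μ.real (Set.Ioi (u * x))| ≤
      2 * μ.real (Set.Ioi (k * (2 * Real.pi) * x)) := by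
  set K : ℝ := k * (2 * Real.pi) with hKdef
  have hK : 0 ≤ K := by positivity
  rw [← integral_primitive_min hμ Real.continuous_sin hK hx]
  simp only [integral_sin, Real.cos_zero]
  have hi1 : Integrable (fun y => 1 - Real.cos (y / x)) μ := by
    refine integrable_of_bounded (by fun_prop) (C := 2) (Eventually.of_forall fun y => ?_)
    rw [abs_le]
    constructor <;> linarith [Real.neg_one_le_cos (y / x), Real.cos_le_one (y / x)]
  have hi2 : Integrable (fun y => 1 - Real.cos (min (y / x) K)) μ := by
    refine integrable_of_bounded (by fun_prop) (C := 2) (Eventually.of_forall fun y => ?_)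
    rw [abs_le]
    constructor <;>
      linarith [Real.neg_one_le_cos (min (y / x) K), Real.cos_le_one (min (y / x) K)]
  rw [← integral_sub hi1 hi2, ← Real.norm_eq_abs]
  have hb : Integrable ((Set.Ioi (K * x)).indicator fun _ => (2 : ℝ)) μ :=
    (integrable_const _).indicator measurableSet_Ioi
  refine (norm_integral_le_of_norm_le hb (Eventually.of_forall fun y => ?_)).trans_eq ?_
  · by_cases hy : K * x < y
    · have h1 : K ≤ y / x := (le_div_iff₀ hx).2 hy.le
      rw [Set.indicator_of_mem (Set.mem_Ioi.2 hy), min_eq_right h1, hKdef,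
        Real.cos_nat_mul_two_pi, Real.norm_eq_abs, abs_le]
      constructor <;> linarith [Real.neg_one_le_cos (y / x), Real.cos_le_one (y / x)]
    · have h1 : y / x ≤ K := (div_le_iff₀ hx).2 (not_lt.1 hy)
      rw [Set.indicator_of_notMem (by simpa using hy), min_eq_left h1]
      simp
  · rw [integral_indicator_const _ measurableSet_Ioi, smul_eq_mul, mul_comm]

/-- Only existence and positivity of the limit are needed, so a Cauchy argument replaces its
evaluation: the truncated integrals converge and the cutoff error tends to `2 K ^ (-β)`, which is
small for large `K`. -/
lemma RegularlyVaryingLaw.exists_tendsto_one_sub_cos (h : RegularlyVaryingLaw μ β)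
    (hβ0 : 0 < β) (hβ2 : β < 2) (hμ : ∀ᵐ y ∂μ, 0 ≤ y) :
    ∃ r > 0, Tendsto (fun x : ℝ => (∫ y, (1 - Real.cos (y / x)) ∂μ) / μ.real (Set.Ioi x))
      atTop (𝓝 r) := by
  have hcauchy : CauchySeq
      (fun x : ℝ => (∫ y, (1 - Real.cos (y / x)) ∂μ) / μ.real (Set.Ioi x)) := by
    refine Metric.cauchySeq_iff'.2 fun ε hε => ?_
    have hK : Tendsto (fun k : ℕ => 2 * ((k : ℝ) * (2 * Real.pi)) ^ (-β)) atTop (𝓝 (2 * 0)) :=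
      (((tendsto_rpow_neg_atTop hβ0).comp
        (tendsto_natCast_atTop_atTop.atTop_mul_const Real.two_pi_pos))).const_mul 2
    rw [mul_zero] at hK
    obtain ⟨k, hk, hk1⟩ := ((hK.eventually_lt_const (show 0 < ε / 4 by positivity)).and
      (eventually_ge_atTop 1)).exists
    have hK0 : 0 < (k : ℝ) * (2 * Real.pi) := by
      have : (0 : ℝ) < k := by exact_mod_cast hk1
      positivity
    have h1 := ((h _ hK0).const_mul 2).eventually_lt_const hk
    have h2 := h.tendsto_integral_truncated hβ0 hβ2 (g := Real.sin) Real.continuous_sin (D := 1)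
      (fun u hu => by rw [one_mul]; exact Real.abs_sin_le_abs.trans_eq (abs_of_nonneg hu)) hK0.le
    set l := ∫ u in (0 : ℝ)..(k * (2 * Real.pi)), Real.sin u * u ^ (-β)
    have h3 := Metric.tendsto_nhds.1 h2 (ε / 4) (by positivity)
    obtain ⟨N, hN⟩ := eventually_atTop.1 (h1.and (h3.and (eventually_gt_atTop 0)))
    have hnear : ∀ x ≥ N, |(∫ y, (1 - Real.cos (y / x)) ∂μ) / μ.real (Set.Ioi x) - l| < ε / 2 := by
      intro x hx
      obtain ⟨a1, a2, a3⟩ := hN x hx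
      have hF := h.tail_pos x
      have a4 := abs_integral_one_sub_cos_sub_le hμ k a3
      rw [Real.dist_eq] at a2
      have a5 : |(∫ y, (1 - Real.cos (y / x)) ∂μ) / μ.real (Set.Ioi x) -
          (∫ u in (0 : ℝ)..(k * (2 * Real.pi)), Real.sin u * μ.real (Set.Ioi (u * x))) /
            μ.real (Set.Ioi x)| < ε / 4 := by
        rw [← sub_div, abs_div, abs_of_pos hF]
        refine lt_of_le_of_lt (div_le_div_of_nonneg_right a4 hF.le) ?_
        rwa [mul_div_assoc]
      refine (abs_sub_le _ _ _).trans_lt ((add_lt_add a5 a2).trans_eq (by ring))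
    refine ⟨N, fun x hx => ?_⟩
    rw [Real.dist_eq]
    have := hnear x hx
    have h' := hnear N le_rfl
    rw [abs_sub_comm] at h'
    exact (abs_sub_le _ l _).trans_lt ((add_lt_add this h').trans_eq (by ring))
  obtain ⟨r, hr⟩ := cauchySeq_tendsto_of_complete hcauchy
  refine ⟨r, ?_, hr⟩
  -- Positivity comes from `x < y ≤ 2 x` alone: there `1 ≤ y / x ≤ 2 < π`, so the integrand is at
  -- least `1 - cos 1`.
  have hlim : Tendsto (fun x : ℝ => (1 - Real.cos 1) *
      (1 - μ.real (Set.Ioi (2 * x)) / μ.real (Set.Ioi x))) atTop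
      (𝓝 ((1 - Real.cos 1) * (1 - 2 ^ (-β)))) := ((h 2 two_pos).const_sub 1).const_mul _
  have hpos : 0 < (1 - Real.cos 1) * (1 - (2 : ℝ) ^ (-β)) := by
    refine mul_pos (sub_pos.2 ?_) (sub_pos.2 ?_)
    · simpa using Real.cos_lt_cos_of_nonneg_of_le_pi le_rfl
        (one_le_two.trans Real.two_le_pi) one_pos
    · exact Real.rpow_lt_one_of_one_lt_of_neg one_lt_two (by linarith)
  refine hpos.trans_le (le_of_tendsto_of_tendsto hlim hr ?_)
  filter_upwards [eventually_gt_atTop 0] with x hx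
  have hF := h.tail_pos x
  rw [le_div_iff₀ hF, mul_assoc, sub_mul 1 (_ / _), one_mul, div_mul_cancel₀ _ hF.ne']
  have hsub : Set.Ioi (2 * x) ⊆ Set.Ioi x := Set.Ioi_subset_Ioi (by linarith)
  rw [← measureReal_sdiff hsub measurableSet_Ioi, mul_comm, ← smul_eq_mul,
    ← integral_indicator_const _ (measurableSet_Ioi.diff measurableSet_Ioi)]
  refine integral_mono_of_nonneg (Eventually.of_forall fun y => ?_) ?_
    (Eventually.of_forall fun y => ?_)
  · exact Set.indicator_nonneg (fun _ _ => sub_nonneg.2 (Real.cos_le_one 1)) y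
  · refine integrable_of_bounded (by fun_prop) (C := 2) (Eventually.of_forall fun y => ?_)
    rw [abs_le]
    constructor <;> linarith [Real.neg_one_le_cos (y / x), Real.cos_le_one (y / x)]
  · by_cases hy : y ∈ Set.Ioi x \ Set.Ioi (2 * x)
    · rw [Set.indicator_of_mem hy]
      have h1 : x < y := hy.1
      have h2 : y ≤ 2 * x := not_lt.1 hy.2
      have h3 : 1 ≤ y / x := (one_le_div hx).2 h1.le
      have h4 : y / x ≤ 2 := (div_le_iff₀ hx).2 h2
      have := Real.cos_le_cos_of_nonneg_of_le_pi zero_le_one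
        (h4.trans Real.two_le_pi) h3
      show 1 - Real.cos 1 ≤ 1 - Real.cos (y / x)
      linarith
    · rw [Set.indicator_of_notMem hy]
      exact sub_nonneg.2 (Real.cos_le_one _)

lemma tendsto_tail_atTop : Tendsto (fun x : ℝ => μ.real (Set.Ioi x)) atTop (𝓝 0) := by
  have h := tendsto_measure_iInter_atTop (μ := μ) (s := fun x : ℝ => Set.Ioi x)
    (fun _ => measurableSet_Ioi.nullMeasurableSet) (fun _ _ h => Set.Ioi_subset_Ioi h)
    ⟨0, measure_ne_top _ _⟩
  have h0 : (⋂ x : ℝ, Set.Ioi x) = ∅ := by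
    ext y
    simp only [Set.mem_iInter, Set.mem_Ioi, Set.mem_empty_iff_false, iff_false, not_forall]
    exact ⟨y, lt_irrefl y⟩
  rw [h0, measure_empty] at h
  have := (ENNReal.tendsto_toReal ENNReal.zero_ne_top).comp h
  rwa [ENNReal.toReal_zero] at this

/-- The sine integral is `o(√F(x))`, with no case split on `β`. Below a fixed `M` it is at most `M /
x`, negligible because `x ^ 2 F(x) → ∞`. Above `M`, a weighted AM-GM inequality trades it for the
truncated second moment, which is `O(F(x))`, and the small mass beyond `M`. -/
lemma RegularlyVaryingLaw.tendsto_integral_sin (h : RegularlyVaryingLaw μ β)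
    (hβ0 : 0 < β) (hβ2 : β < 2) (hμ : ∀ᵐ y ∂μ, 0 ≤ y) :
    Tendsto (fun x : ℝ => (∫ y, Real.sin (y / x) ∂μ) ^ 2 / μ.real (Set.Ioi x)) atTop (𝓝 0) := by
  obtain ⟨C, hC, hCx⟩ := h.eventually_integral_min_sq_le hβ0 hβ2 hμ
  have key : Tendsto (fun x : ℝ => (∫ y, Real.sin (y / x) ∂μ) / √(μ.real (Set.Ioi x)))
      atTop (𝓝 0) := by
    rw [Metric.tendsto_nhds]
    intro ε hε
    obtain ⟨θ, hθ, hθε⟩ : ∃ θ > 0, (C + 1) * θ < ε / 2 :=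
      ⟨ε / (4 * (C + 1)), by positivity, by field_simp; norm_num⟩
    obtain ⟨M, hM, hM0⟩ := ((tendsto_tail_atTop (μ := μ)).eventually_le_const
      (show 0 < θ ^ 2 by positivity)).and (eventually_gt_atTop 0) |>.exists
    have h2 : Tendsto (fun x : ℝ => M * (√(x ^ (2 : ℝ) * μ.real (Set.Ioi x)))⁻¹) atTop
        (𝓝 (M * 0)) :=
      ((Real.tendsto_sqrt_atTop.comp
        (h.tendsto_rpow_mul_tail hβ0 hβ2)).inv_tendsto_atTop).const_mul M
    rw [mul_zero] at h2
    filter_upwards [hCx, eventually_gt_atTop 0,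
      h2.eventually_lt_const (show 0 < ε / 2 by positivity)] with x hx hx0 hxM
    have hF := h.tail_pos x
    set f := √(μ.real (Set.Ioi x)) with hf
    have hf0 : 0 < f := Real.sqrt_pos.2 hF
    have hff : μ.real (Set.Ioi x) = f ^ 2 := (Real.sq_sqrt hF.le).symm
    rw [Real.sqrt_mul (by positivity), Real.rpow_two, Real.sqrt_sq hx0.le, ← hf] at hxM
    rw [Real.dist_eq, sub_zero, abs_div, abs_of_pos hf0, div_lt_iff₀ hf0]
    have hmin : Integrable (fun y => (min (y / x) 1) ^ 2) μ := by
      refine integrable_of_bounded (by fun_prop) (C := 1) ?_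
      filter_upwards [hμ] with y hy
      have h0 : 0 ≤ min (y / x) 1 := le_min (by positivity) zero_le_one
      rw [abs_of_nonneg (by positivity)]
      exact pow_le_one₀ h0 (min_le_right _ _)
    have hind : Integrable ((Set.Ioi M).indicator fun _ => (f / θ)) μ :=
      (integrable_const _).indicator measurableSet_Ioi
    have hb : Integrable (fun y => M / x + (θ / f * (min (y / x) 1) ^ 2 +
        (Set.Ioi M).indicator (fun _ => (f / θ)) y)) μ :=
      (integrable_const _).add ((hmin.const_mul _).add hind)
    have hle := norm_integral_le_of_norm_le (μ := μ) (f := fun y => Real.sin (y / x)) hb (by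
      filter_upwards [hμ] with y hy
      have hy' : 0 ≤ y / x := by positivity
      have h0 : 0 ≤ min (y / x) 1 := le_min hy' zero_le_one
      have hs : |Real.sin (y / x)| ≤ min (y / x) 1 :=
        le_min (Real.abs_sin_le_abs.trans_eq (abs_of_nonneg hy')) (Real.abs_sin_le_one _)
      rw [Real.norm_eq_abs]
      by_cases hyM : M < y
      · rw [Set.indicator_of_mem (Set.mem_Ioi.2 hyM)]
        refine hs.trans ?_
        have e1 : 0 ≤ M / x := by positivity
        -- Completing the square: this is the AM-GM inequality, with a weight that balances a second
        -- moment of order `f ^ 2` against a mass of at most `θ ^ 2`.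
        have e2 : θ / f * (min (y / x) 1) ^ 2 + f / θ - min (y / x) 1 =
            θ / f * ((min (y / x) 1 - f / (2 * θ)) ^ 2 + 3 * f ^ 2 / (4 * θ ^ 2)) := by
          field_simp
          ring
        have e3 : 0 ≤ θ / f * ((min (y / x) 1 - f / (2 * θ)) ^ 2 + 3 * f ^ 2 / (4 * θ ^ 2)) := by
          positivity
        linarith
      · rw [Set.indicator_of_notMem (by simpa using hyM)]
        have e1 : y / x ≤ M / x := div_le_div_of_nonneg_right (not_lt.1 hyM) hx0.le
        have e2 : 0 ≤ θ / f * (min (y / x) 1) ^ 2 := by positivity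
        linarith [min_le_left (y / x) 1])
    rw [Real.norm_eq_abs] at hle
    refine hle.trans_lt ?_
    have hadd : Integrable (fun y => θ / f * (min (y / x) 1) ^ 2 +
        (Set.Ioi M).indicator (fun _ => (f / θ)) y) μ := (hmin.const_mul _).add hind
    rw [integral_add (integrable_const _) hadd,
      integral_add (hmin.const_mul _) hind, integral_const_mul,
      integral_indicator_const _ measurableSet_Ioi]
    simp only [integral_const, probReal_univ, smul_eq_mul]
    have e1 : θ / f * ∫ y, (min (y / x) 1) ^ 2 ∂μ ≤ C * θ * f := by
      calc θ / f * ∫ y, (min (y / x) 1) ^ 2 ∂μ ≤ θ / f * (C * f ^ 2) := by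
            rw [← hff]; gcongr
        _ = C * θ * f := by field_simp
    have e2 : μ.real (Set.Ioi M) * (f / θ) ≤ θ * f := by
      calc μ.real (Set.Ioi M) * (f / θ) ≤ θ ^ 2 * (f / θ) := by gcongr
        _ = θ * f := by field_simp
    have e3 : M / x < ε / 2 * f := by
      rw [← div_lt_iff₀ hf0]
      refine lt_of_eq_of_lt ?_ hxM
      field_simp
    nlinarith
  have h2 := key.pow 2
  simp only [div_pow, ne_eq, OfNat.ofNat_ne_zero, not_false_eq_true, zero_pow] at h2
  refine h2.congr fun x => ?_
  rw [Real.sq_sqrt measureReal_nonneg]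

lemma norm_charFun_inv_sq (x : ℝ) :
    ‖charFun μ x⁻¹‖ ^ 2 = (1 - ∫ y, (1 - Real.cos (y / x)) ∂μ) ^ 2 +
      (∫ y, Real.sin (y / x) ∂μ) ^ 2 := by
  have hc : Integrable (fun y => Real.cos (y / x)) μ :=
    integrable_of_bounded (by fun_prop) (Eventually.of_forall fun y => Real.abs_cos_le_one _)
  have hs : Integrable (fun y => Real.sin (y / x)) μ :=
    integrable_of_bounded (by fun_prop) (Eventually.of_forall fun y => Real.abs_sin_le_one _)
  have h1 : charFun μ x⁻¹ = ((∫ y, Real.cos (y / x) ∂μ : ℝ) : ℂ) +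
      ((∫ y, Real.sin (y / x) ∂μ : ℝ) : ℂ) * Complex.I := by
    rw [charFun_apply_real, ← integral_complex_ofReal, ← integral_complex_ofReal, ← integral_mul_const,
      ← integral_add hc.ofReal (hs.ofReal.mul_const _)]
    congr 1
    ext y
    rw [Complex.ofReal_cos, Complex.ofReal_sin, ← Complex.exp_mul_I]
    congr 2
    push_cast
    ring
  rw [h1, Complex.sq_norm, Complex.normSq_add_mul_I, integral_sub (integrable_const _) hc]
  simp

end CharFun

/-! ### From the stable limit to a pure power tail -/

section TailConstant

/-- After taking logarithms, `D` is squeezed between `(1 - D) (-log (1 - D))` and `-log (1 - D)`. -/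
lemma tendsto_nat_mul_of_one_sub_pow {D : ℕ → ℝ} {τ : ℝ} (hD : Tendsto D atTop (𝓝 0))
    (h : Tendsto (fun n => (1 - D n) ^ n) atTop (𝓝 (Real.exp (-τ)))) :
    Tendsto (fun n : ℕ => n * D n) atTop (𝓝 τ) := by
  have hlog : Tendsto (fun n : ℕ => -(n * Real.log (1 - D n))) atTop (𝓝 τ) := by
    have := (h.log (Real.exp_pos _).ne').neg
    simpa [Real.log_pow] using this
  have hlow : Tendsto (fun n : ℕ => (1 - D n) * -(n * Real.log (1 - D n))) atTop (𝓝 τ) := by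
    simpa using (hD.const_sub 1).mul hlog
  refine tendsto_of_tendsto_of_tendsto_of_le_of_le' hlow hlog ?_ ?_
  · filter_upwards [hD.eventually_lt_const one_pos] with n hn
    have h1 : 0 < 1 - D n := by linarith
    have h2 := Real.one_sub_inv_le_log_of_pos h1
    have h3 : (1 - D n) * -Real.log (1 - D n) ≤ D n := by
      calc (1 - D n) * -Real.log (1 - D n) ≤ (1 - D n) * ((1 - D n)⁻¹ - 1) := by
            gcongr; linarith
        _ = D n := by field_simp; ring
    calc (1 - D n) * -(n * Real.log (1 - D n)) = n * ((1 - D n) * -Real.log (1 - D n)) := by ring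
      _ ≤ n * D n := by gcongr
  · filter_upwards [hD.eventually_lt_const one_pos] with n hn
    have h2 := Real.log_le_sub_one_of_pos (show 0 < 1 - D n by linarith)
    calc n * D n ≤ n * -Real.log (1 - D n) := by gcongr; linarith
      _ = _ := by ring

/-- With `n = ⌊x ^ β⌋₊`, monotonicity puts `x ^ β F(x)` between `n F((n + 1) ^ (1/β))` and `(n + 1)
F(n ^ (1/β))`; the unit shifts cost only a term `F → 0`. -/
lemma tendsto_rpow_mul_of_tendsto_nat {F : ℝ → ℝ} (hF : Antitone F)
    (hF0 : Tendsto F atTop (𝓝 0)) {β c : ℝ} (hβ : 0 < β)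
    (h : Tendsto (fun n : ℕ => n * F ((n : ℝ) ^ (1 / β))) atTop (𝓝 c)) :
    Tendsto (fun x : ℝ => x ^ β * F x) atTop (𝓝 c) := by
  have hnn : ∀ x, 0 ≤ F x := fun x => hF.le_of_tendsto hF0 x
  have hz : Tendsto (fun n : ℕ => (n : ℝ) ^ (1 / β)) atTop atTop :=
    (tendsto_rpow_atTop (by positivity)).comp tendsto_natCast_atTop_atTop
  have hup : Tendsto (fun n : ℕ => ((n : ℝ) + 1) * F ((n : ℝ) ^ (1 / β))) atTop (𝓝 c) := by
    have := h.add (hF0.comp hz)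
    rw [add_zero] at this
    exact this.congr fun n => by simp only [Function.comp]; ring
  have hlow : Tendsto (fun n : ℕ => (n : ℝ) * F (((n : ℝ) + 1) ^ (1 / β))) atTop (𝓝 c) := by
    have := (tendsto_add_atTop_iff_nat 1).2 (h.sub (hF0.comp hz))
    rw [sub_zero] at this
    refine this.congr fun n => ?_
    simp only [Function.comp]
    push_cast
    ring
  have hfl : Tendsto (fun x : ℝ => ⌊x ^ β⌋₊) atTop atTop :=
    tendsto_nat_floor_atTop.comp (tendsto_rpow_atTop hβ)
  refine tendsto_of_tendsto_of_tendsto_of_le_of_le' (hlow.comp hfl) (hup.comp hfl) ?_ ?_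
  · filter_upwards [eventually_gt_atTop 0] with x hx
    simp only [Function.comp]
    have hx' : x = (x ^ β) ^ (1 / β) := by
      rw [← Real.rpow_mul hx.le, mul_one_div_cancel hβ.ne', Real.rpow_one]
    refine mul_le_mul (Nat.floor_le (by positivity)) (hF ?_) (hnn _) (by positivity)
    conv_lhs => rw [hx']
    exact Real.rpow_le_rpow (by positivity) (Nat.lt_floor_add_one _).le (by positivity)
  · filter_upwards [eventually_gt_atTop 0] with x hx
    simp only [Function.comp]
    have hx' : x = (x ^ β) ^ (1 / β) := by
      rw [← Real.rpow_mul hx.le, mul_one_div_cancel hβ.ne', Real.rpow_one]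
    refine mul_le_mul (Nat.lt_floor_add_one _).le (hF ?_) (hnn _) (by positivity)
    conv_rhs => rw [hx']
    exact Real.rpow_le_rpow (by positivity) (Nat.floor_le (by positivity)) (by positivity)

/-- A regularly varying tail whose characteristic function obeys the pure power scaling
is asymptotic to a pure power. -/
lemma RegularlyVaryingLaw.exists_tendsto_rpow_mul_tail {μ : Measure ℝ} [IsProbabilityMeasure μ]
    {β τ : ℝ} (h : RegularlyVaryingLaw μ β) (hβ0 : 0 < β) (hβ2 : β < 2)
    (hμ : ∀ᵐ y ∂μ, 0 ≤ y) (hτ : 0 < τ)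
    (hφ : Tendsto (fun n : ℕ => ‖charFun μ ((n : ℝ) ^ (1 / β))⁻¹‖ ^ n) atTop
      (𝓝 (Real.exp (-τ)))) :
    ∃ c > 0, Tendsto (fun x : ℝ => x ^ β * μ.real (Set.Ioi x)) atTop (𝓝 c) := by
  obtain ⟨r, hr0, hr⟩ := h.exists_tendsto_one_sub_cos hβ0 hβ2 hμ
  have hB := h.tendsto_integral_sin hβ0 hβ2 hμ
  have hF0 := tendsto_tail_atTop (μ := μ)
  have hA : Tendsto (fun x : ℝ => ∫ y, (1 - Real.cos (y / x)) ∂μ) atTop (𝓝 0) := by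
    have := hr.mul hF0
    rw [mul_zero] at this
    exact this.congr fun x => div_mul_cancel₀ _ (h.tail_pos x).ne'
  set D : ℝ → ℝ := fun x => 1 - ‖charFun μ x⁻¹‖ ^ 2 with hDdef
  -- With `A` and `B` the integrals of `1 - cos` and `sin`, one has `D = A (2 - A) - B ^ 2`.
  have hDF : Tendsto (fun x => D x / μ.real (Set.Ioi x)) atTop (𝓝 (2 * r)) := by
    have := (hr.mul (hA.const_sub 2)).sub hB
    rw [sub_zero, sub_zero, mul_comm r 2] at this
    refine this.congr fun x => ?_
    simp only [hDdef, norm_charFun_inv_sq]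
    have := (h.tail_pos x).ne'
    field_simp
    ring
  have hD0 : Tendsto D atTop (𝓝 0) := by
    have := hDF.mul hF0
    rw [mul_zero] at this
    exact this.congr fun x => div_mul_cancel₀ _ (h.tail_pos x).ne'
  have hz : Tendsto (fun n : ℕ => (n : ℝ) ^ (1 / β)) atTop atTop :=
    (tendsto_rpow_atTop (by positivity)).comp tendsto_natCast_atTop_atTop
  have hnD : Tendsto (fun n : ℕ => n * D ((n : ℝ) ^ (1 / β))) atTop (𝓝 (2 * τ)) := by
    refine tendsto_nat_mul_of_one_sub_pow (hD0.comp hz) ?_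
    have := hφ.pow 2
    rw [← Real.exp_nat_mul] at this
    convert this using 2
    · simp only [hDdef]
      ring
    · push_cast; ring_nf
  refine ⟨τ / r, by positivity, tendsto_rpow_mul_of_tendsto_nat antitone_tail hF0 hβ0 ?_⟩
  -- Dividing `n D` by `D / F` leaves `n F`, with limit `2 τ / (2 r)`.
  have := hnD.div (hDF.comp hz) (by positivity)
  rw [mul_div_mul_left _ _ two_ne_zero] at this
  refine this.congr' ?_
  filter_upwards [(hDF.comp hz).eventually_ne (show 2 * r ≠ 0 by positivity)] with n hn
  have h1 := h.tail_pos ((n : ℝ) ^ (1 / β))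
  simp only [Function.comp, Pi.div_apply] at hn ⊢
  have h2 : D ((n : ℝ) ^ (1 / β)) ≠ 0 := fun h0 => hn (by rw [h0, zero_div])
  field_simp

variable {Ω : Type*} [MeasurableSpace Ω] {P : Measure Ω}

/-- Translation by `a` only multiplies the characteristic function by a phase, so the unknown
centering constants disappear in the modulus. -/
lemma norm_charFun_map_normalized_sum {X : ℕ → Ω → ℝ} (hindep : iIndepFun X P)
    (hident : ∀ j, IdentDistrib (X j) (X 0) P P) (n : ℕ) (a s : ℝ) :
    ‖charFun (P.map fun ω => ((∑ k ∈ Finset.range n, X k ω) - a) / s) 1‖ =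
      ‖charFun (P.map (X 0)) s⁻¹‖ ^ n := by
  have hm : ∀ j, AEMeasurable (X j) P := fun j => (hident j).aemeasurable_fst
  have hsum : AEMeasurable (fun ω => ∑ k ∈ Finset.range n, X k ω) P :=
    Finset.aemeasurable_fun_sum _ fun k _ => hm k
  have h1 : (fun ω => ((∑ k ∈ Finset.range n, X k ω) - a) / s) =
      fun ω => s⁻¹ * ((∑ k ∈ Finset.range n, X k ω) + -a) := by
    ext ω; rw [div_eq_inv_mul, sub_eq_add_neg]
  rw [h1, charFun_map_mul_comp (hsum.add_const _), mul_one]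
  have h2 : P.map (fun ω => (∑ k ∈ Finset.range n, X k ω) + -a) =
      (P.map (fun ω => ∑ k ∈ Finset.range n, X k ω)).map (fun y => y + -a) :=
    (AEMeasurable.map_map_of_aemeasurable (g := fun y : ℝ => y + -a) (by fun_prop) hsum).symm
  rw [h2, charFun_map_add_const, norm_mul]
  have h3 : (fun ω => ∑ k ∈ Finset.range n, X k ω) = ∑ i : Fin n, X i := by
    ext ω
    rw [Finset.sum_range, Finset.sum_apply]
  have h4 := iIndepFun.charFun_map_sum_eq_prod (P := P) (X := fun i : Fin n => X i)
    (fun i => hm i) (hindep.precomp Fin.val_injective)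
  rw [h3, h4]
  simp only [Finset.prod_apply, fun i : Fin n => (hident i).map_eq, Finset.prod_const,
    Finset.card_univ, Fintype.card_fin, norm_pow]
  rw [Complex.norm_exp]
  simp

lemma InNormalDomainOfAttraction.tendsto_norm_charFun [IsProbabilityMeasure P]
    {X : ℕ → Ω → ℝ} {β : ℝ}
    (h : InNormalDomainOfAttraction P X β) (hindep : iIndepFun X P)
    (hident : ∀ j, IdentDistrib (X j) (X 0) P P) :
    ∃ τ > 0, Tendsto (fun n : ℕ => ‖charFun (P.map (X 0)) ((n : ℝ) ^ (1 / β))⁻¹‖ ^ n) atTop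
      (𝓝 (Real.exp (-τ))) := by
  obtain ⟨ν, ⟨σ, δ, hσ, hν⟩, a, hlim⟩ := h
  refine ⟨σ ^ β, Real.rpow_pos_of_pos hσ β, ?_⟩
  have h1 := (ProbabilityMeasure.tendsto_iff_tendsto_charFun.1 hlim.tendsto 1).norm
  simp only [ProbabilityMeasure.coe_mk, Measure.map_id, hν 1,
    norm_charFun_map_normalized_sum hindep hident] at h1
  convert h1 using 2
  -- The skewness contributes only to the imaginary part of the exponent, so its value is irrelevant
  -- to the modulus.
  generalize ((SignType.sign (1 : ℝ) : ℝ)) * Real.tan (Real.pi * β / 2) = q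
  rw [Complex.norm_exp]
  congr 1
  simp

end TailConstant

/-! ### Moments of a truncated innovation -/

section Moments

variable {μ : Measure ℝ} [IsProbabilityMeasure μ] {β C : ℝ}

lemma exists_tail_le_rpow {c : ℝ} (hβ : 0 < β)
    (h : Tendsto (fun x : ℝ => x ^ β * μ.real (Set.Ioi x)) atTop (𝓝 c)) :
    ∃ C > 0, ∀ x > 0, μ.real (Set.Ioi x) ≤ C * x ^ (-β) := by
  obtain ⟨N, hN⟩ := eventually_atTop.1 (h.eventually_le_const (lt_add_one c))
  set M := max N 1
  have hM : 0 < M := lt_of_lt_of_le one_pos (le_max_right _ _)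
  refine ⟨max (c + 1) (M ^ β), lt_max_of_lt_right (Real.rpow_pos_of_pos hM β), fun x hx => ?_⟩
  rw [Real.rpow_neg hx.le, ← div_eq_mul_inv, le_div_iff₀ (Real.rpow_pos_of_pos hx β), mul_comm]
  rcases le_total M x with hMx | hMx
  · exact (hN x ((le_max_left _ _).trans hMx)).trans (le_max_left _ _)
  · refine le_trans ?_ (le_max_right _ _)
    calc x ^ β * μ.real (Set.Ioi x) ≤ M ^ β * 1 :=
          mul_le_mul (Real.rpow_le_rpow hx.le hMx hβ.le) measureReal_le_one measureReal_nonneg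
            (by positivity)
      _ = M ^ β := mul_one _

lemma integral_pow_mul_tail_le (hC : ∀ x > 0, μ.real (Set.Ioi x) ≤ C * x ^ (-β)) (p : ℕ)
    (hp : β < p + 1) {a : ℝ} (ha : 0 < a) :
    ∫ u in (0 : ℝ)..a, u ^ p * μ.real (Set.Ioi u) ≤
      C / (p + 1 - β) * a ^ (p + 1 - β : ℝ) := by
  have hint : IntervalIntegrable (fun u : ℝ => C * u ^ (p - β : ℝ)) volume 0 a :=
    (intervalIntegral.intervalIntegrable_rpow' (by linarith)).const_mul _
  have hint' : IntervalIntegrable (fun u : ℝ => u ^ p * μ.real (Set.Ioi u)) volume 0 a :=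
    (antitone_tail.intervalIntegrable (a := 0) (b := a)).continuousOn_mul
      (continuous_pow p).continuousOn
  have hle : ∫ u in (0 : ℝ)..a, u ^ p * μ.real (Set.Ioi u) ≤
      ∫ u in (0 : ℝ)..a, C * u ^ (p - β : ℝ) := by
    refine intervalIntegral.integral_mono_on_of_le_Ioo ha.le hint' hint fun u hu => ?_
    calc u ^ p * μ.real (Set.Ioi u) ≤ u ^ p * (C * u ^ (-β)) :=
          mul_le_mul_of_nonneg_left (hC u hu.1) (pow_nonneg hu.1.le p)
      _ = C * u ^ (p - β : ℝ) := by
        rw [sub_eq_add_neg, Real.rpow_add hu.1, Real.rpow_natCast]; ring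
  refine hle.trans_eq ?_
  rw [intervalIntegral.integral_const_mul, integral_rpow (Or.inl (by linarith)),
    show (p - β + 1 : ℝ) = p + 1 - β by ring, Real.zero_rpow (by linarith)]
  ring

/-- Truncation to zero of the values exceeding `a`. -/
def truncate (a : ℝ) : ℝ → ℝ := (Set.Iic a).indicator id

lemma measurable_truncate (a : ℝ) : Measurable (truncate a) :=
  measurable_id.indicator measurableSet_Iic

lemma truncate_nonneg {a y : ℝ} (hy : 0 ≤ y) : 0 ≤ truncate a y :=
  Set.indicator_apply_nonneg fun _ => hy

lemma truncate_le_min {a y : ℝ} (ha : 0 ≤ a) (hy : 0 ≤ y) : truncate a y ≤ min y a := by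
  by_cases h : y ≤ a
  · rw [truncate, Set.indicator_of_mem (Set.mem_Iic.2 h), min_eq_left h, id]
  · rw [truncate, Set.indicator_of_notMem (by simpa using h)]
    exact le_min hy ha

lemma abs_truncate_le {a y : ℝ} (ha : 0 ≤ a) (hy : 0 ≤ y) : |truncate a y| ≤ a := by
  rw [abs_of_nonneg (truncate_nonneg hy)]
  exact (truncate_le_min ha hy).trans (min_le_right _ _)

lemma integral_truncate_sq_le (hμ : ∀ᵐ y ∂μ, 0 ≤ y) (hβ : β < 2)
    (hC : ∀ x > 0, μ.real (Set.Ioi x) ≤ C * x ^ (-β)) {a : ℝ} (ha : 0 < a) :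
    ∫ y, truncate a y ^ 2 ∂μ ≤ 2 * C / (2 - β) * a ^ (2 - β) := by
  have h1 := integral_primitive_min hμ (g := fun u => 2 * u) (by fun_prop) ha.le one_pos
  have h2 := integral_pow_mul_tail_le hC 1 (by norm_num; linarith) ha
  norm_num at h2
  have hp : ∀ y : ℝ, ∫ u in (0 : ℝ)..min (y / 1) a, 2 * u = min y a ^ 2 := by
    intro y
    rw [intervalIntegral.integral_const_mul, integral_id, div_one]
    ring
  simp only [hp, mul_one, mul_assoc, intervalIntegral.integral_const_mul] at h1
  have hint : Integrable (fun y => min y a ^ 2) μ := by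
    refine integrable_of_bounded (by fun_prop) (C := a ^ 2) ?_
    filter_upwards [hμ] with y hy
    have h0 : 0 ≤ min y a := le_min hy ha.le
    rw [abs_of_nonneg (by positivity)]
    gcongr
    exact min_le_right _ _
  calc ∫ y, truncate a y ^ 2 ∂μ ≤ ∫ y, min y a ^ 2 ∂μ := by
        refine integral_mono_of_nonneg (Eventually.of_forall fun y => sq_nonneg _) hint ?_
        filter_upwards [hμ] with y hy
        exact pow_le_pow_left₀ (truncate_nonneg hy) (truncate_le_min ha.le hy) 2
    _ = 2 * ∫ u in (0 : ℝ)..a, u * μ.real (Set.Ioi u) := h1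
    _ ≤ 2 * (C / (2 - β) * a ^ (2 - β)) := by gcongr
    _ = _ := by ring

lemma integral_truncate_le (hμ : ∀ᵐ y ∂μ, 0 ≤ y) (hβ : β < 1)
    (hC : ∀ x > 0, μ.real (Set.Ioi x) ≤ C * x ^ (-β)) {a : ℝ} (ha : 0 < a) :
    ∫ y, truncate a y ∂μ ≤ C / (1 - β) * a ^ (1 - β) := by
  have h1 := integral_primitive_min hμ (g := fun _ => 1) (by fun_prop) ha.le one_pos
  have h2 := integral_pow_mul_tail_le hC 0 (by norm_num; linarith) ha
  norm_num at h2
  simp only [intervalIntegral.integral_const, div_one, mul_one, smul_eq_mul, one_mul,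
    sub_zero] at h1
  have hint : Integrable (fun y => min y a) μ := by
    refine integrable_of_bounded (by fun_prop) (C := a) ?_
    filter_upwards [hμ] with y hy
    rw [abs_of_nonneg (le_min hy ha.le)]
    exact min_le_right _ _
  calc ∫ y, truncate a y ∂μ ≤ ∫ y, min y a ∂μ := by
        refine integral_mono_of_nonneg ?_ hint ?_
        · filter_upwards [hμ] with y hy using truncate_nonneg hy
        · filter_upwards [hμ] with y hy using truncate_le_min ha.le hy
    _ ≤ _ := h1.trans_le h2

/-- Layer cake: the exceedance probability of `y 1_{y > a}` at level `t` is bounded by the tail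
bound at `max t a`, giving one term from `(0, a]` and one from `(a, ∞)`. The Lebesgue integral form
yields integrability as well as the bound. -/
lemma lintegral_indicator_Ioi_le (hβ : 1 < β) (hC0 : 0 ≤ C)
    (hC : ∀ x > 0, μ.real (Set.Ioi x) ≤ C * x ^ (-β)) {a : ℝ} (ha : 0 < a) :
    ∫⁻ y, ENNReal.ofReal ((Set.Ioi a).indicator id y) ∂μ ≤
      ENNReal.ofReal (C * (β / (β - 1)) * a ^ (1 - β)) := by
  have hnn : ∀ y, 0 ≤ (Set.Ioi a).indicator id y := fun y =>
    Set.indicator_nonneg (fun z hz => (ha.trans hz).le) y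
  rw [lintegral_eq_lintegral_meas_lt μ (Eventually.of_forall hnn)
    (measurable_id.indicator measurableSet_Ioi).aemeasurable, ← Set.Ioc_union_Ioi_eq_Ioi ha.le]
  rw [lintegral_union measurableSet_Ioi (Set.Ioc_disjoint_Ioi le_rfl)]
  have hsub : ∀ t, 0 < t → ∀ b, 0 < b → b ≤ max t a →
      μ {y | t < (Set.Ioi a).indicator id y} ≤ ENNReal.ofReal (C * b ^ (-β)) := by
    intro t ht b hb hbt
    have h1 : {y | t < (Set.Ioi a).indicator id y} ⊆ Set.Ioi b := by
      intro y hy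
      have hy' : t < (Set.Ioi a).indicator id y := hy
      by_cases hya : a < y
      · rw [Set.indicator_of_mem (Set.mem_Ioi.2 hya), id] at hy'
        exact lt_of_le_of_lt hbt (max_lt hy' hya)
      · rw [Set.indicator_of_notMem (by simpa using hya)] at hy'
        exact absurd hy' ht.le.not_gt
    refine (measure_mono h1).trans ?_
    rw [← ofReal_measureReal]
    exact ENNReal.ofReal_le_ofReal (hC b hb)
  have hI1 : ∫⁻ t in Set.Ioc 0 a, μ {y | t < (Set.Ioi a).indicator id y} ≤
      ENNReal.ofReal (C * a ^ (-β) * a) := by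
    calc ∫⁻ t in Set.Ioc 0 a, μ {y | t < (Set.Ioi a).indicator id y}
        ≤ ∫⁻ _ in Set.Ioc 0 a, ENNReal.ofReal (C * a ^ (-β)) :=
          setLIntegral_mono' measurableSet_Ioc fun t ht => hsub t ht.1 a ha (le_max_right _ _)
      _ = _ := by
        rw [setLIntegral_const, Real.volume_Ioc, sub_zero,
          ENNReal.ofReal_mul (p := C * a ^ (-β)) (by positivity)]
  have hI2 : ∫⁻ t in Set.Ioi a, μ {y | t < (Set.Ioi a).indicator id y} ≤
      ENNReal.ofReal (C * (-a ^ (-β + 1) / (-β + 1))) := by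
    calc ∫⁻ t in Set.Ioi a, μ {y | t < (Set.Ioi a).indicator id y}
        ≤ ∫⁻ t in Set.Ioi a, ENNReal.ofReal (C * t ^ (-β)) :=
          setLIntegral_mono' measurableSet_Ioi fun t ht =>
            hsub t (ha.trans ht) t (ha.trans ht) (le_max_left _ _)
      _ = _ := by
        rw [← integral_Ioi_rpow_of_lt (by linarith) ha, ← integral_const_mul,
          ofReal_integral_eq_lintegral_ofReal
            ((integrableOn_Ioi_rpow_of_lt (by linarith) ha).const_mul C)]
        refine (ae_restrict_iff' measurableSet_Ioi).2 (Eventually.of_forall fun t ht => ?_)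
        exact mul_nonneg hC0 (Real.rpow_nonneg (ha.trans ht).le _)
  refine (add_le_add hI1 hI2).trans_eq ?_
  have hβ' : 0 < β - 1 := by linarith
  have e : -a ^ (-β + 1) / (-β + 1) = a ^ (-β + 1) / (β - 1) := by
    rw [show -β + 1 = -(β - 1) by ring, neg_div_neg_eq]
  rw [e, ← ENNReal.ofReal_add (by positivity) (by positivity), mul_assoc,
    ← Real.rpow_add_one ha.ne', show -β + 1 = 1 - β by ring]
  congr 1
  field_simp
  ring

lemma integrable_id_of_tail_le (hμ : ∀ᵐ y ∂μ, 0 ≤ y) (hβ : 1 < β) (hC0 : 0 ≤ C)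
    (hC : ∀ x > 0, μ.real (Set.Ioi x) ≤ C * x ^ (-β)) : Integrable (fun y : ℝ => y) μ := by
  have h1 : Integrable ((Set.Ioi (1 : ℝ)).indicator id) μ := by
    refine ⟨(measurable_id.indicator measurableSet_Ioi).aestronglyMeasurable, ?_⟩
    have hnn : ∀ y, 0 ≤ (Set.Ioi (1 : ℝ)).indicator id y := fun y =>
      Set.indicator_nonneg (fun z hz => (one_pos.trans hz).le) y
    rw [hasFiniteIntegral_iff_ofReal (Eventually.of_forall hnn)]
    exact (lintegral_indicator_Ioi_le hβ hC0 hC one_pos).trans_lt ENNReal.ofReal_lt_top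
  have h2 : Integrable (truncate 1) μ := by
    refine integrable_of_bounded (measurable_truncate 1) (C := 1) ?_
    filter_upwards [hμ] with y hy using abs_truncate_le zero_le_one hy
  refine (h2.add h1).congr (Eventually.of_forall fun y => ?_)
  have := congrFun (Set.indicator_self_add_compl (Set.Iic (1 : ℝ)) id) y
  rwa [Set.compl_Iic] at this

lemma integral_sub_truncate_le (hμ : ∀ᵐ y ∂μ, 0 ≤ y) (hβ : 1 < β) (hC0 : 0 ≤ C)
    (hC : ∀ x > 0, μ.real (Set.Ioi x) ≤ C * x ^ (-β)) {a : ℝ} (ha : 0 < a) :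
    |∫ y, truncate a y ∂μ - ∫ y, y ∂μ| ≤ C * (β / (β - 1)) * a ^ (1 - β) := by
  have hβ' : 0 < β - 1 := by linarith
  have h2 : Integrable (truncate a) μ := by
    refine integrable_of_bounded (measurable_truncate a) (C := a) ?_
    filter_upwards [hμ] with y hy using abs_truncate_le ha.le hy
  have hnn : ∀ y, 0 ≤ (Set.Ioi a).indicator id y := fun y =>
    Set.indicator_nonneg (fun z hz => (ha.trans hz).le) y
  rw [abs_sub_comm, ← integral_sub (integrable_id_of_tail_le hμ hβ hC0 hC) h2]
  have : ∀ y, y - truncate a y = (Set.Ioi a).indicator id y := by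
    intro y
    have := congrFun (Set.indicator_self_add_compl (Set.Iic a) id) y
    rw [Set.compl_Iic] at this
    simp only [Pi.add_apply, id] at this
    rw [sub_eq_iff_eq_add, add_comm]
    exact this.symm
  simp only [this]
  rw [abs_of_nonneg (integral_nonneg hnn), integral_eq_lintegral_of_nonneg_ae
    (Eventually.of_forall hnn) (measurable_id.indicator measurableSet_Ioi).aestronglyMeasurable]
  refine ENNReal.toReal_le_of_le_ofReal (by positivity) (lintegral_indicator_Ioi_le hβ hC0 hC ha)

/-- The bias of the truncated mean, relative to `0` or to the mean according to `β`. -/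
lemma exists_abs_integral_truncate_sub_le (hμ : ∀ᵐ y ∂μ, 0 ≤ y) (hβ : β ≠ 1) (hC0 : 0 ≤ C)
    (hC : ∀ x > 0, μ.real (Set.Ioi x) ≤ C * x ^ (-β)) :
    ∃ D > 0, ∀ a > 0,
      |∫ y, truncate a y ∂μ - (if β < 1 then 0 else ∫ y, y ∂μ)| ≤ D * a ^ (1 - β) := by
  split_ifs with h1
  · refine ⟨C / (1 - β) + 1, ?_, fun a ha => ?_⟩
    · have : 0 ≤ C / (1 - β) := div_nonneg hC0 (by linarith)
      linarith
    · have h0 : 0 ≤ ∫ y, truncate a y ∂μ := by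
        refine integral_nonneg_of_ae ?_
        filter_upwards [hμ] with y hy using truncate_nonneg hy
      rw [sub_zero, abs_of_nonneg h0, add_mul]
      have := integral_truncate_le hμ h1 hC ha
      have h2 : 0 ≤ a ^ (1 - β) := Real.rpow_nonneg ha.le _
      linarith
  · have h1' : 1 < β := lt_of_le_of_ne (not_lt.1 h1) hβ.symm
    refine ⟨C * (β / (β - 1)) + 1, ?_, fun a ha => ?_⟩
    · have : 0 ≤ C * (β / (β - 1)) := mul_nonneg hC0 (div_nonneg (by linarith) (by linarith))
      linarith
    · have := integral_sub_truncate_le hμ h1' hC0 hC ha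
      have h2 : 0 ≤ a ^ (1 - β) := Real.rpow_nonneg ha.le _
      rw [add_mul]
      linarith

end Moments

/-! ### Bonferroni bounds and deterministic truncation inequalities -/

section Events

variable {Ω ι : Type*} [MeasurableSpace Ω] {P : Measure Ω}

/-- A Bonferroni bound. Inductively, adding an event of probability `p` to a total `σ` loses at most
`σ p`, which the growth of the square from `σ ^ 2` to `(σ + p) ^ 2` absorbs. -/
lemma le_measureReal_biUnion [IsProbabilityMeasure P] [DecidableEq ι] {A : ι → Set Ω}
    (hA : ∀ i, NullMeasurableSet (A i) P)
    (hpair : ∀ i j, i ≠ j → P.real (A i ∩ A j) = P.real (A i) * P.real (A j)) (s : Finset ι) :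
    ∑ i ∈ s, P.real (A i) - (∑ i ∈ s, P.real (A i)) ^ 2 ≤ P.real (⋃ i ∈ s, A i) := by
  induction s using Finset.induction_on with
  | empty => simp
  | insert a s ha ih =>
    have h1 := measureReal_union_add_inter₀ (μ := P) (s := ⋃ i ∈ s, A i) (hA a)
      (measure_ne_top _ _) (measure_ne_top _ _)
    have h2 : P.real ((⋃ i ∈ s, A i) ∩ A a) ≤ (∑ i ∈ s, P.real (A i)) * P.real (A a) := by
      rw [Set.iUnion₂_inter, Finset.sum_mul]
      refine (measureReal_biUnion_finset_le s _).trans (Finset.sum_le_sum fun i hi => ?_)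
      exact (hpair i a fun h => ha (h ▸ hi)).le
    rw [Finset.set_biUnion_insert, Set.union_comm, Finset.sum_insert ha]
    have h3 : 0 ≤ P.real (A a) := measureReal_nonneg
    have h4 : 0 ≤ ∑ i ∈ s, P.real (A i) := Finset.sum_nonneg fun _ _ => measureReal_nonneg
    nlinarith [mul_nonneg h3 h4, mul_nonneg h3 h3]

lemma measureReal_pair_le [DecidableEq ι] {A : ι → Set Ω}
    (hpair : ∀ i j, i ≠ j → P.real (A i ∩ A j) = P.real (A i) * P.real (A j)) (s : Finset ι) :
    P.real (⋃ i ∈ s, ⋃ j ∈ s.erase i, A i ∩ A j) ≤ (∑ i ∈ s, P.real (A i)) ^ 2 := by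
  rw [sq, Finset.sum_mul]
  refine (measureReal_biUnion_finset_le s _).trans (Finset.sum_le_sum fun i _ => ?_)
  refine (measureReal_biUnion_finset_le _ _).trans ?_
  rw [Finset.mul_sum]
  refine (Finset.sum_le_sum fun j hj => (hpair i j (Finset.ne_of_mem_erase hj).symm).le).trans ?_
  exact Finset.sum_le_sum_of_subset_of_nonneg (Finset.erase_subset i s) fun _ _ _ => by positivity

lemma mul_truncate_div {v θ x : ℝ} (hv : 0 < v) :
    v * truncate (θ / v) x = truncate θ (v * x) := by
  simp only [truncate, Set.indicator, Set.mem_Iic, le_div_iff₀ hv, mul_comm x v, id]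
  split_ifs <;> simp

lemma truncate_eq_self {θ x : ℝ} (h : x ≤ θ) : truncate θ x = x :=
  Set.indicator_of_mem (Set.mem_Iic.2 h) _

lemma truncate_eq_zero {θ x : ℝ} (h : θ < x) : truncate θ x = 0 :=
  Set.indicator_of_notMem (by simpa using h) _

lemma truncate_le_self {θ x : ℝ} (hx : 0 ≤ x) : truncate θ x ≤ x :=
  Set.indicator_apply_le' (fun _ => le_rfl) fun _ => hx

/-- At most one term exceeds `θ`; truncation sends exactly that term to zero, and it is at most `M`.
-/
lemma sum_le_sum_truncate_add [DecidableEq ι] {s : Finset ι} {z : ι → ℝ} {θ M : ℝ} (hM : 0 ≤ M)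
    (hz : ∀ i ∈ s, z i ≤ M) (huniq : ∀ i ∈ s, ∀ j ∈ s, θ < z i → θ < z j → i = j) :
    ∑ i ∈ s, z i ≤ ∑ i ∈ s, truncate θ (z i) + M := by
  by_cases h : ∃ j ∈ s, θ < z j
  · obtain ⟨j, hj, hθ⟩ := h
    rw [← Finset.add_sum_erase s _ hj, ← Finset.add_sum_erase s (fun i => truncate θ (z i)) hj,
      truncate_eq_zero hθ]
    have : ∑ i ∈ s.erase j, z i = ∑ i ∈ s.erase j, truncate θ (z i) := by
      refine Finset.sum_congr rfl fun i hi => (truncate_eq_self (not_lt.1 fun hi' => ?_)).symm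
      exact Finset.ne_of_mem_erase hi (huniq i (Finset.mem_of_mem_erase hi) j hj hi' hθ)
    rw [this]
    linarith [hz j hj]
  · push Not at h
    have : ∑ i ∈ s, z i = ∑ i ∈ s, truncate θ (z i) :=
      Finset.sum_congr rfl fun i hi => (truncate_eq_self (h i hi)).symm
    linarith

lemma sum_truncate_add_le [DecidableEq ι] {s : Finset ι} {z : ι → ℝ} {θ : ℝ} (hz : ∀ i ∈ s, 0 ≤ z i)
    {j : ι} (hj : j ∈ s) (hθ : θ < z j) :
    ∑ i ∈ s, truncate θ (z i) + z j ≤ ∑ i ∈ s, z i := by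
  rw [← Finset.add_sum_erase s _ hj, ← Finset.add_sum_erase s z hj, truncate_eq_zero hθ]
  have : ∑ i ∈ s.erase j, truncate θ (z i) ≤ ∑ i ∈ s.erase j, z i :=
    Finset.sum_le_sum fun i hi => truncate_le_self (hz i (Finset.mem_of_mem_erase hi))
  linarith

end Events

/-! ### Uniform estimates for weighted sums -/

section Weighted

variable {Ω : Type*} [MeasurableSpace Ω] {P : Measure Ω} [IsProbabilityMeasure P]
  {X : ℕ → Ω → ℝ} {β : ℝ}

/-- The centering of a single innovation. -/
def innovationMean (P : Measure Ω) (X : ℕ → Ω → ℝ) (β : ℝ) : ℝ :=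
  if β < 1 then 0 else ∫ ω, X 0 ω ∂P

/-- Truncating `v_i X_i` at `θ` means truncating `X_i` at `θ / v_i`. The powers of `v_i` then
combine so that bias and variance are each a function of `θ` times `v_i ^ β`. The bias uses half of
`η`; Chebyshev on the other half produces the factor `4`. -/
lemma measureReal_truncated_sum_deviation_le (hindep : iIndepFun X P)
    (hident : ∀ j, IdentDistrib (X j) (X 0) P P) (hnonneg : ∀ᵐ ω ∂P, 0 ≤ X 0 ω)
    {C₁ C₂ b : ℝ}
    (h1 : ∀ a > 0, |∫ y, truncate a y ∂(P.map (X 0)) - b| ≤ C₁ * a ^ (1 - β))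
    (h2 : ∀ a > 0, ∫ y, truncate a y ^ 2 ∂(P.map (X 0)) ≤ C₂ * a ^ (2 - β))
    (s : Finset ℕ) {v : ℕ → ℝ} (hv : ∀ i ∈ s, 0 < v i) {θ η : ℝ} (hθ : 0 < θ) (hη : 0 < η)
    (hbias : C₁ * θ ^ (1 - β) * ∑ i ∈ s, v i ^ β ≤ η / 2) :
    P.real {ω | η ≤ |∑ i ∈ s, truncate θ (v i * X i ω) - ∑ i ∈ s, v i * b|} ≤
      4 * C₂ * θ ^ (2 - β) / η ^ 2 * ∑ i ∈ s, v i ^ β := by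
  have hm : ∀ j, AEMeasurable (X j) P := fun j => (hident j).aemeasurable_fst
  have hnn : ∀ j, ∀ᵐ ω ∂P, 0 ≤ X j ω := fun j =>
    (hident j).symm.ae_snd (p := fun x => 0 ≤ x) measurableSet_Ici hnonneg
  set T : ℕ → Ω → ℝ := fun i ω => v i * truncate (θ / v i) (X i ω) with hT
  have hTm : ∀ i, AEMeasurable (T i) P := fun i =>
    ((measurable_truncate _).comp_aemeasurable (hm i)).const_mul _
  have hTLp : ∀ i ∈ s, MemLp (T i) 2 P := by
    intro i hi
    have hvi := hv i hi
    refine MemLp.of_bound (hTm i).aestronglyMeasurable (v i * (θ / v i)) ?_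
    filter_upwards [hnn i] with ω hω
    rw [hT, norm_mul, Real.norm_of_nonneg hvi.le, Real.norm_eq_abs]
    exact mul_le_mul_of_nonneg_left (abs_truncate_le (by positivity) hω) hvi.le
  have hsumT : ∀ ω, ∑ i ∈ s, truncate θ (v i * X i ω) = (∑ i ∈ s, T i) ω := by
    intro ω
    rw [Finset.sum_apply]
    exact Finset.sum_congr rfl fun i hi => (mul_truncate_div (hv i hi)).symm
  have hlaw : ∀ (i : ℕ) (g : ℝ → ℝ), Measurable g →
      ∫ ω, g (X i ω) ∂P = ∫ y, g y ∂(P.map (X 0)) := by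
    intro i g hg
    rw [← (hident i).map_eq, integral_map (hm i) hg.aestronglyMeasurable]
  have hvar : Var[∑ i ∈ s, T i; P] ≤ C₂ * θ ^ (2 - β) * ∑ i ∈ s, v i ^ β := by
    rw [IndepFun.variance_sum hTLp]
    · rw [Finset.mul_sum]
      refine Finset.sum_le_sum fun i hi => ?_
      have hvi := hv i hi
      refine (variance_const_mul (v i) _ P).le.trans ?_
      have h3 := variance_le_expectation_sq (μ := P)
        ((measurable_truncate (θ / v i)).comp_aemeasurable (hm i)).aestronglyMeasurable
      have h4 : ∫ ω, ((truncate (θ / v i) ∘ X i) ^ 2) ω ∂P =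
          ∫ y, truncate (θ / v i) y ^ 2 ∂(P.map (X 0)) :=
        hlaw i (fun y => truncate (θ / v i) y ^ 2) ((measurable_truncate _).pow_const 2)
      rw [h4] at h3
      calc v i ^ 2 * Var[fun ω => truncate (θ / v i) (X i ω); P]
          ≤ v i ^ 2 * (C₂ * (θ / v i) ^ (2 - β)) := by
            gcongr
            exact h3.trans (h2 _ (by positivity))
        _ = C₂ * θ ^ (2 - β) * v i ^ β := by
          rw [Real.div_rpow hθ.le hvi.le, Real.rpow_sub hvi, Real.rpow_two]
          field_simp
    · intro i _ j _ hij
      exact (hindep.indepFun hij).comp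
        (φ := fun y => v i * truncate (θ / v i) y) (ψ := fun y => v j * truncate (θ / v j) y)
        ((measurable_truncate _).const_mul _) ((measurable_truncate _).const_mul _)
  have hmean : |∫ ω, (∑ i ∈ s, T i) ω ∂P - ∑ i ∈ s, v i * b| ≤ η / 2 := by
    refine le_trans ?_ hbias
    simp only [Finset.sum_apply]
    rw [integral_finsetSum _ fun i hi => (hTLp i hi).integrable (by norm_num),
      ← Finset.sum_sub_distrib, Finset.mul_sum]
    refine (Finset.abs_sum_le_sum_abs _ _).trans (Finset.sum_le_sum fun i hi => ?_)
    have hvi := hv i hi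
    simp only [hT]
    rw [integral_const_mul, hlaw i _ (measurable_truncate _), ← mul_sub, abs_mul, abs_of_pos hvi]
    calc v i * |∫ y, truncate (θ / v i) y ∂(P.map (X 0)) - b|
        ≤ v i * (C₁ * (θ / v i) ^ (1 - β)) := by
          gcongr
          exact h1 _ (by positivity)
      _ = C₁ * θ ^ (1 - β) * v i ^ β := by
        rw [Real.div_rpow hθ.le hvi.le, Real.rpow_sub hvi, Real.rpow_one]
        field_simp
  have hcheb := meas_ge_le_variance_div_sq (μ := P) (memLp_finsetSum' s hTLp)
    (half_pos hη)
  have hsub : {ω | η ≤ |∑ i ∈ s, truncate θ (v i * X i ω) - ∑ i ∈ s, v i * b|} ⊆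
      {ω | η / 2 ≤ |(∑ i ∈ s, T i) ω - ∫ ω, (∑ i ∈ s, T i) ω ∂P|} := by
    intro ω hω
    have hω' : η ≤ |∑ i ∈ s, truncate θ (v i * X i ω) - ∑ i ∈ s, v i * b| := hω
    show η / 2 ≤ |(∑ i ∈ s, T i) ω - ∫ ω, (∑ i ∈ s, T i) ω ∂P|
    rw [hsumT] at hω'
    have := abs_sub_le ((∑ i ∈ s, T i) ω) (∫ ω, (∑ i ∈ s, T i) ω ∂P) (∑ i ∈ s, v i * b)
    linarith
  have h0 : 0 ≤ Var[∑ i ∈ s, T i; P] / (η / 2) ^ 2 := div_nonneg (variance_nonneg _ _) (sq_nonneg _)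
  calc P.real {ω | η ≤ |∑ i ∈ s, truncate θ (v i * X i ω) - ∑ i ∈ s, v i * b|}
      ≤ P.real {ω | η / 2 ≤ |(∑ i ∈ s, T i) ω - ∫ ω, (∑ i ∈ s, T i) ω ∂P|} :=
        measureReal_mono hsub
    _ ≤ Var[∑ i ∈ s, T i; P] / (η / 2) ^ 2 := ENNReal.toReal_le_of_le_ofReal h0 hcheb
    _ ≤ C₂ * θ ^ (2 - β) * (∑ i ∈ s, v i ^ β) / (η / 2) ^ 2 := by gcongr
    _ = _ := by field_simp; ring

/-- A small total `∑ v_i ^ β` makes every `v_i` small, so all arguments `t / v_i` lie in the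
asymptotic range at once and the terms can be compared one by one. -/
lemma exists_abs_sum_tail_sub_le {F : ℝ → ℝ} {c : ℝ} (hβ : 0 < β)
    (h : Tendsto (fun x : ℝ => x ^ β * F x) atTop (𝓝 c)) {t ε : ℝ} (ht : 0 < t) (hε : 0 < ε) :
    ∃ δ > 0, ∀ (s : Finset ℕ) (v : ℕ → ℝ), (∀ i ∈ s, 0 < v i) → ∑ i ∈ s, v i ^ β ≤ δ →
      |∑ i ∈ s, F (t / v i) - c * t ^ (-β) * ∑ i ∈ s, v i ^ β| ≤ ε * ∑ i ∈ s, v i ^ β := by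
  have htβ : 0 < t ^ β := Real.rpow_pos_of_pos ht β
  obtain ⟨N, hN⟩ := eventually_atTop.1 (Metric.tendsto_nhds.1 h (ε * t ^ β) (by positivity))
  set M := max N 1
  have hM : 0 < M := lt_of_lt_of_le one_pos (le_max_right _ _)
  have hMβ : 0 < M ^ β := Real.rpow_pos_of_pos hM β
  refine ⟨t ^ β / M ^ β, by positivity, fun s v hv hV => ?_⟩
  rw [Finset.mul_sum, Finset.mul_sum, ← Finset.sum_sub_distrib]
  refine (Finset.abs_sum_le_sum_abs _ _).trans (Finset.sum_le_sum fun i hi => ?_)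
  have hvi := hv i hi
  have hviβ : 0 < v i ^ β := Real.rpow_pos_of_pos hvi β
  have h1 : v i ^ β ≤ t ^ β / M ^ β := le_trans
    (Finset.single_le_sum (f := fun i => v i ^ β)
      (fun j hj => Real.rpow_nonneg (hv j hj).le β) hi) hV
  have h2 : M ≤ t / v i := by
    rw [le_div_iff₀ hMβ, ← Real.mul_rpow hvi.le hM.le] at h1
    rw [le_div_iff₀ hvi, mul_comm]
    exact (Real.rpow_le_rpow_iff (by positivity) ht.le hβ).1 h1
  have h3 := hN (t / v i) ((le_max_left _ _).trans h2)
  rw [Real.dist_eq, Real.div_rpow ht.le hvi.le] at h3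
  have h4 : F (t / v i) - c * t ^ (-β) * v i ^ β =
      (t ^ β / v i ^ β * F (t / v i) - c) * (v i ^ β / t ^ β) := by
    rw [Real.rpow_neg ht.le]
    field_simp
  rw [h4, abs_mul, abs_of_pos (div_pos hviβ htβ)]
  calc |t ^ β / v i ^ β * F (t / v i) - c| * (v i ^ β / t ^ β)
      ≤ ε * t ^ β * (v i ^ β / t ^ β) := by gcongr
    _ = ε * v i ^ β := by field_simp

end Weighted

/-! ### The single big jump principle -/

section SingleBigJump

variable {Ω : Type*} [MeasurableSpace Ω] {P : Measure Ω} [IsProbabilityMeasure P]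
  {X : ℕ → Ω → ℝ} {β : ℝ}

/-- The principle of a single big jump, with explicit truncation level `θ` and margin `η`. -/
lemma single_big_jump_bounds (hindep : iIndepFun X P)
    (hident : ∀ j, IdentDistrib (X j) (X 0) P P) (hnonneg : ∀ᵐ ω ∂P, 0 ≤ X 0 ω)
    (s : Finset ℕ) {v : ℕ → ℝ} (hv : ∀ i ∈ s, 0 < v i) {θ η : ℝ} (hθ1 : θ ≤ 1)
    (hη : 0 < η) (hη1 : η < 1) (B : ℝ) :
    P.real {ω | 1 < ∑ i ∈ s, v i * X i ω - B} ≤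
        ∑ i ∈ s, (P.map (X 0)).real (Set.Ioi ((1 - η) / v i)) +
        (∑ i ∈ s, (P.map (X 0)).real (Set.Ioi (θ / v i))) ^ 2 +
        P.real {ω | η ≤ |∑ i ∈ s, truncate θ (v i * X i ω) - B|} ∧
    ∑ i ∈ s, (P.map (X 0)).real (Set.Ioi ((1 + η) / v i)) -
        (∑ i ∈ s, (P.map (X 0)).real (Set.Ioi ((1 + η) / v i))) ^ 2 -
        P.real {ω | η ≤ |∑ i ∈ s, truncate θ (v i * X i ω) - B|} ≤
      P.real {ω | 1 < ∑ i ∈ s, v i * X i ω - B} := by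
  have hm : ∀ j, AEMeasurable (X j) P := fun j => (hident j).aemeasurable_fst
  have hnn : ∀ᵐ ω ∂P, ∀ j, 0 ≤ X j ω := ae_all_iff.2 fun j =>
    (hident j).symm.ae_snd (p := fun x => 0 ≤ x) measurableSet_Ici hnonneg
  set A : ℝ → ℕ → Set Ω := fun t i => X i ⁻¹' Set.Ioi (t / v i) with hAdef
  have hA : ∀ t i, P.real (A t i) = (P.map (X 0)).real (Set.Ioi (t / v i)) := by
    intro t i
    rw [← (hident i).map_eq, map_measureReal_apply_of_aemeasurable (hm i) measurableSet_Ioi]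
  have hpair : ∀ t i j, i ≠ j → P.real (A t i ∩ A t j) = P.real (A t i) * P.real (A t j) := by
    intro t i j hij
    simp only [hAdef, measureReal_def]
    rw [(hindep.indepFun hij).measure_inter_preimage_eq_mul _ _ measurableSet_Ioi
      measurableSet_Ioi, ENNReal.toReal_mul]
  have hmem : ∀ t, ∀ i ∈ s, ∀ ω, ω ∈ A t i ↔ t < v i * X i ω := by
    intro t i hi ω
    show t / v i < X i ω ↔ _
    rw [div_lt_iff₀ (hv i hi), mul_comm]
  set E := {ω | 1 < ∑ i ∈ s, v i * X i ω - B}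
  set G := {ω | η ≤ |∑ i ∈ s, truncate θ (v i * X i ω) - B|}
  set N := {ω | ¬ ∀ j, 0 ≤ X j ω}
  have hN : P.real N = 0 := by rw [measureReal_def, ae_iff.1 hnn, ENNReal.toReal_zero]
  constructor
  · have hsub : E ⊆ ((⋃ i ∈ s, A (1 - η) i) ∪ (⋃ i ∈ s, ⋃ j ∈ s.erase i, A θ i ∩ A θ j)) ∪ G := by
      intro ω hω
      have hω' : 1 < ∑ i ∈ s, v i * X i ω - B := hω
      by_contra hcon
      simp only [Set.mem_union, Set.mem_iUnion, Set.mem_inter_iff, not_or, not_exists] at hcon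
      obtain ⟨⟨h1, h2⟩, h3⟩ := hcon
      have h4 := sum_le_sum_truncate_add (s := s) (z := fun i => v i * X i ω) (θ := θ)
        (M := 1 - η) (by linarith)
        (fun i hi => not_lt.1 fun h => h1 i hi ((hmem _ i hi ω).2 h)) (by
          intro i hi j hj hi' hj'
          by_contra hij
          exact h2 i hi j (Finset.mem_erase.2 ⟨Ne.symm hij, hj⟩)
            ⟨(hmem _ i hi ω).2 hi', (hmem _ j hj ω).2 hj'⟩)
      have h5 : ¬ η ≤ |∑ i ∈ s, truncate θ (v i * X i ω) - B| := h3
      have h6 := le_abs_self (∑ i ∈ s, truncate θ (v i * X i ω) - B)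
      exact h5 (by linarith)
    refine (measureReal_mono hsub).trans ((measureReal_union_le _ _).trans ?_)
    gcongr
    refine (measureReal_union_le _ _).trans (add_le_add ?_ ?_)
    · refine (measureReal_biUnion_finset_le _ _).trans_eq (Finset.sum_congr rfl fun i _ => hA _ i)
    · refine (measureReal_pair_le (hpair θ) s).trans_eq ?_
      simp only [hA]
  · have hsub : (⋃ i ∈ s, A (1 + η) i) ⊆ (E ∪ G) ∪ N := by
      intro ω hω
      by_contra hcon
      simp only [Set.mem_union, not_or] at hcon
      obtain ⟨⟨h1, h2⟩, h3⟩ := hcon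
      have h3' : ∀ j, 0 ≤ X j ω := not_not.1 h3
      have h1' : ¬ 1 < ∑ i ∈ s, v i * X i ω - B := h1
      have h2' : ¬ η ≤ |∑ i ∈ s, truncate θ (v i * X i ω) - B| := h2
      obtain ⟨j, hj, hωj⟩ := Set.mem_iUnion₂.1 hω
      have h4 := (hmem _ j hj ω).1 hωj
      have h5 := sum_truncate_add_le (s := s) (z := fun i => v i * X i ω) (θ := θ)
        (fun i hi => mul_nonneg (hv i hi).le (h3' i)) hj (show θ < v j * X j ω by linarith)
      have h6 := neg_abs_le (∑ i ∈ s, truncate θ (v i * X i ω) - B)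
      push Not at h1' h2'
      linarith
    have h1 := le_measureReal_biUnion (P := P) (A := A (1 + η))
      (fun i => (hm i).nullMeasurableSet_preimage measurableSet_Ioi) (hpair (1 + η)) s
    have h2 := measureReal_mono (μ := P) hsub
    have h3 := measureReal_union_le (μ := P) (E ∪ G) N
    have h4 := measureReal_union_le (μ := P) E G
    simp only [hA] at h1
    linarith

/-- The order of choices matters: first `η`, so that `c (1 ± η) ^ (-β)` is close to `c`; then `θ`,
depending on `η`, so that the Chebyshev term is a small multiple of `V` (possible since `β < 2`);
last `δ`. The factor `θ ^ (1 - β)` in the bias may be large when `β > 1`, but it is fixed by then.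
-/
theorem weighted_sum_large_deviation (hβ0 : 0 < β) (hβ2 : β < 2) (hβ1 : β ≠ 1)
    (hindep : iIndepFun X P) (hident : ∀ j, IdentDistrib (X j) (X 0) P P)
    (hnonneg : ∀ᵐ ω ∂P, 0 ≤ X 0 ω) {c : ℝ}
    (hc : Tendsto (fun x : ℝ => x ^ β * (P.map (X 0)).real (Set.Ioi x)) atTop (𝓝 c))
    {ε : ℝ} (hε : 0 < ε) :
    ∃ δ > 0, ∀ (s : Finset ℕ) (v : ℕ → ℝ), (∀ i ∈ s, 0 < v i) → ∑ i ∈ s, v i ^ β ≤ δ →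
      |P.real {ω | 1 < ∑ i ∈ s, v i * X i ω - ∑ i ∈ s, v i * innovationMean P X β} -
        c * ∑ i ∈ s, v i ^ β| ≤ ε * ∑ i ∈ s, v i ^ β := by
  have hm : AEMeasurable (X 0) P := (hident 0).aemeasurable_fst
  have hprob : IsProbabilityMeasure (P.map (X 0)) := Measure.isProbabilityMeasure_map hm
  set μ := P.map (X 0) with hμdef
  have hμ : ∀ᵐ y ∂μ, 0 ≤ y := (ae_map_iff hm measurableSet_Ici).2 hnonneg
  obtain ⟨C, hC0, hC⟩ := exists_tail_le_rpow hβ0 hc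
  obtain ⟨C₁, hC₁, hbias⟩ := exists_abs_integral_truncate_sub_le hμ hβ1 hC0.le hC
  have hmean : (if β < 1 then 0 else ∫ y, y ∂μ) = innovationMean P X β := by
    have : ∫ y, y ∂μ = ∫ ω, X 0 ω ∂P :=
      integral_map (f := fun y : ℝ => y) hm aestronglyMeasurable_id
    rw [innovationMean, this]
  rw [hmean] at hbias
  set C₂ := 2 * C / (2 - β) with hC₂def
  have hC₂ : 0 < C₂ := div_pos (by positivity) (by linarith)
  have hsq : ∀ a > 0, ∫ y, truncate a y ^ 2 ∂μ ≤ C₂ * a ^ (2 - β) := fun a ha =>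
    integral_truncate_sq_le hμ hβ2 hC ha
  have hcont : ∀ σ : ℝ, Tendsto (fun η : ℝ => c * (1 + σ * η) ^ (-β)) (𝓝[>] 0) (𝓝 c) := by
    intro σ
    have h1 : ContinuousAt (fun η : ℝ => c * (1 + σ * η) ^ (-β)) 0 := by
      refine continuousAt_const.mul (ContinuousAt.rpow_const (by fun_prop) (Or.inl (by simp)))
    have h2 := h1.tendsto
    simp only [mul_zero, add_zero, Real.one_rpow, mul_one] at h2
    exact h2.mono_left nhdsWithin_le_nhds
  obtain ⟨η, ⟨hη1, hη2⟩, hη0, hη3⟩ :=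
    ((((hcont (-1)).eventually_le_const (show c < c + ε / 8 by linarith)).and
      ((hcont 1).eventually_const_le (show c - ε / 8 < c by linarith))).and
      (Ioo_mem_nhdsGT (show (0 : ℝ) < 1 by norm_num))).exists
  rw [neg_one_mul, ← sub_eq_add_neg] at hη1
  rw [one_mul] at hη2
  have hθlim : Tendsto (fun θ : ℝ => 4 * C₂ * θ ^ (2 - β) / η ^ 2) (𝓝[>] 0) (𝓝 0) := by
    have h1 : Tendsto (fun θ : ℝ => θ ^ (2 - β)) (𝓝[>] 0) (𝓝 0) := by
      have := (Real.continuousAt_rpow_const 0 (2 - β) (Or.inr (by linarith))).tendsto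
      rw [Real.zero_rpow (by linarith)] at this
      exact this.mono_left nhdsWithin_le_nhds
    simpa using (h1.const_mul (4 * C₂)).div_const (η ^ 2)
  obtain ⟨θ, hθ1, hθ0, hθ3⟩ := ((hθlim.eventually_le_const (show 0 < ε / 8 by positivity)).and
    (Ioo_mem_nhdsGT (show (0 : ℝ) < 1 by norm_num))).exists
  obtain ⟨δ₁, hδ₁, hd1⟩ := exists_abs_sum_tail_sub_le hβ0 hc (show 0 < 1 - η by linarith)
    (show 0 < ε / 8 by positivity)
  obtain ⟨δ₂, hδ₂, hd2⟩ := exists_abs_sum_tail_sub_le hβ0 hc (show 0 < 1 + η by linarith)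
    (show 0 < ε / 8 by positivity)
  have hθβ : 0 < θ ^ (-β) := Real.rpow_pos_of_pos hθ0 _
  have hθβ' : 0 < θ ^ (1 - β) := Real.rpow_pos_of_pos hθ0 _
  -- The last two bounds make the bias at most `η / 2` and the quadratic terms at most `ε / 8 * V`.
  refine ⟨min (min δ₁ δ₂) (min (η / 2 / (C₁ * θ ^ (1 - β))) (ε / 8 / (C * θ ^ (-β)) ^ 2)),
    by positivity, fun s v hv hV => ?_⟩
  obtain ⟨⟨hV1, hV2⟩, hV3, hV4⟩ : (_ ∧ _) ∧ _ ∧ _ := by simpa only [le_min_iff] using hV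
  replace hd1 := abs_le.1 (hd1 s v hv hV1)
  replace hd2 := abs_le.1 (hd2 s v hv hV2)
  rw [le_div_iff₀ (by positivity)] at hV3 hV4
  set V := ∑ i ∈ s, v i ^ β
  have hV0 : 0 ≤ V := Finset.sum_nonneg fun i hi => Real.rpow_nonneg (hv i hi).le _
  have hG := measureReal_truncated_sum_deviation_le hindep hident hnonneg hbias hsq s hv hθ0 hη0
    (by linarith)
  have hG' := hG.trans (mul_le_mul_of_nonneg_right hθ1 hV0)
  rw [← Finset.sum_mul] at hG'
  obtain ⟨hup, hlow⟩ := single_big_jump_bounds hindep hident hnonneg s hv hθ3.le hη0 hη3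
    (∑ i ∈ s, v i * innovationMean P X β)
  rw [← Finset.sum_mul] at hup hlow ⊢
  have hQ : ∀ t ≥ θ, (∑ i ∈ s, μ.real (Set.Ioi (t / v i))) ^ 2 ≤ ε / 8 * V := by
    intro t ht
    have h1 : ∑ i ∈ s, μ.real (Set.Ioi (t / v i)) ≤ C * θ ^ (-β) * V := by
      rw [Finset.mul_sum]
      refine Finset.sum_le_sum fun i hi => ?_
      have hvi := hv i hi
      refine (antitone_tail (div_le_div_of_nonneg_right ht hvi.le)).trans
        ((hC _ (by positivity)).trans_eq ?_)
      rw [Real.div_rpow hθ0.le hvi.le, Real.rpow_neg hvi.le, div_inv_eq_mul, mul_assoc]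
    calc (∑ i ∈ s, μ.real (Set.Ioi (t / v i))) ^ 2 ≤ (C * θ ^ (-β) * V) ^ 2 :=
          pow_le_pow_left₀ (Finset.sum_nonneg fun _ _ => measureReal_nonneg) h1 2
      _ = V * (C * θ ^ (-β)) ^ 2 * V := by ring
      _ ≤ ε / 8 * V := by gcongr
  have hQ1 := hQ θ le_rfl
  have hQ2 := hQ (1 + η) (by linarith)
  have e1 := mul_le_mul_of_nonneg_right hη1 hV0
  have e2 := mul_le_mul_of_nonneg_right hη2 hV0
  have e3 : 0 ≤ ε * V := by positivity
  rw [abs_le]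
  constructor <;> linarith [hd1.1, hd1.2, hd2.1, hd2.2]

end SingleBigJump

/-! ### Growth of the scale for algebraic kernels -/

section AlgebraicKernel

lemma scale_eq_sum_range (m : ℕ → ℝ) (β : ℝ) (n : ℕ) :
    scale m β n = ∑ j ∈ Finset.range n, (∑ i ∈ Finset.range (n - j), m i) ^ β := by
  rw [scale, ← Finset.Ico_add_one_right_eq_Icc, Finset.sum_Ico_eq_sum_range]
  refine Finset.sum_congr (by simp) fun j hj => ?_
  rw [Finset.mem_range] at hj
  rw [show n - (1 + j) + 1 = n - j by omega]

/-- Reversing the order frees the summands from `n`, as required for Stolz–Cesàro summation. -/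
lemma scale_eq_sum_range_reflect (m : ℕ → ℝ) (β : ℝ) (n : ℕ) :
    scale m β n = ∑ j ∈ Finset.range n, (∑ i ∈ Finset.range (j + 1), m i) ^ β := by
  rw [scale_eq_sum_range,
    ← Finset.sum_range_reflect (fun j => (∑ i ∈ Finset.range (j + 1), m i) ^ β)]
  refine Finset.sum_congr rfl fun j hj => ?_
  rw [Finset.mem_range] at hj
  rw [show n - 1 - j + 1 = n - j by omega]

lemma tendsto_rpow_increment_div {q : ℝ} :
    Tendsto (fun i : ℕ => (((i : ℝ) + 1) ^ q - (i : ℝ) ^ q) / ((i : ℝ) + 1) ^ (q - 1)) atTop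
      (𝓝 q) := by
  -- Factoring out `(i + 1) ^ q` turns the increment into a difference quotient of `(1 - x) ^ q` at
  -- `x = 1 / (i + 1)`.
  have hd : HasDerivAt (fun x : ℝ => (1 - x) ^ q) (-q) 0 := by
    have h := ((hasDerivAt_id (0 : ℝ)).const_sub 1).rpow_const (p := q) (Or.inl (by simp))
    simpa using h
  have hs := (hasDerivAt_iff_tendsto_slope.1 hd).neg
  rw [neg_neg] at hs
  have hx : Tendsto (fun i : ℕ => 1 / ((i : ℝ) + 1)) atTop (𝓝[≠] 0) := by
    refine tendsto_nhdsWithin_iff.2 ⟨tendsto_one_div_add_atTop_nhds_zero_nat, ?_⟩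
    exact Eventually.of_forall fun i => (Nat.one_div_pos_of_nat (α := ℝ)).ne'
  refine (hs.comp hx).congr fun i => ?_
  have hi : (0 : ℝ) < (i : ℝ) + 1 := by positivity
  have h1 : (1 : ℝ) - 1 / ((i : ℝ) + 1) = i / (i + 1) := by field_simp; ring
  simp only [Function.comp, slope_def_field, sub_zero, Real.one_rpow, h1]
  rw [Real.div_rpow (by positivity) hi.le, Real.rpow_sub_one hi.ne']
  have : 0 < ((i : ℝ) + 1) ^ q := Real.rpow_pos_of_pos hi q
  field_simp
  ring

/-- Stolz–Cesàro: `f` is compared with the increments of `i ^ (p + 1)`, which are positive and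
telescope to a divergent sum because `p > -1`. -/
lemma tendsto_sum_range_div_rpow {f : ℕ → ℝ} {p L : ℝ} (hp : -1 < p)
    (h : Tendsto (fun i : ℕ => f i / ((i : ℝ) + 1) ^ p) atTop (𝓝 L)) :
    Tendsto (fun n : ℕ => (∑ i ∈ Finset.range n, f i) / (n : ℝ) ^ (p + 1)) atTop
      (𝓝 (L / (p + 1))) := by
  have hq : 0 < p + 1 := by linarith
  set g : ℕ → ℝ := fun i => ((i : ℝ) + 1) ^ (p + 1) - (i : ℝ) ^ (p + 1) with hg
  have hgpos : ∀ i, 0 < g i := fun i =>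
    sub_pos.2 (Real.rpow_lt_rpow (by positivity) (lt_add_one _) hq)
  have hsum : ∀ n : ℕ, ∑ i ∈ Finset.range n, g i = (n : ℝ) ^ (p + 1) := by
    intro n
    have := Finset.sum_range_sub (fun i : ℕ => (i : ℝ) ^ (p + 1)) n
    simp only [Nat.cast_add, Nat.cast_one, Nat.cast_zero, Real.zero_rpow hq.ne', sub_zero] at this
    exact this
  have hatTop : Tendsto (fun n : ℕ => (n : ℝ) ^ (p + 1)) atTop atTop :=
    (tendsto_rpow_atTop hq).comp tendsto_natCast_atTop_atTop
  have hratio : Tendsto (fun i => f i / g i) atTop (𝓝 (L / (p + 1))) := by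
    have h1 := tendsto_rpow_increment_div (q := p + 1)
    rw [add_sub_cancel_right] at h1
    refine (h.div h1 hq.ne').congr fun i => ?_
    have : (0 : ℝ) < ((i : ℝ) + 1) ^ p := Real.rpow_pos_of_pos (by positivity) p
    simp only [Pi.div_apply]
    rw [div_div_div_cancel_right₀ this.ne']
  have ho : (fun i => f i - L / (p + 1) * g i) =o[atTop] g := by
    rw [Asymptotics.isLittleO_iff_tendsto fun i hi => absurd hi (hgpos i).ne']
    have := hratio.sub_const (L / (p + 1))
    rw [sub_self] at this
    refine this.congr fun i => ?_
    have := (hgpos i).ne'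
    field_simp
  have hS := ho.sum_range (fun i => (hgpos i).le) (by simpa only [hsum] using hatTop)
  simp only [Finset.sum_sub_distrib, ← Finset.mul_sum, hsum] at hS
  have hS' := hS.tendsto_div_nhds_zero.add_const (L / (p + 1))
  rw [zero_add] at hS'
  refine hS'.congr' ?_
  filter_upwards [hatTop.eventually_gt_atTop 0] with n hn
  field_simp
  ring

/-- The summation lemma is applied with `p = -ν` to the kernel, and then with `p = β (1 - ν)` to the
`β`-th powers of its partial sums. -/
theorem exists_tendsto_scale_algebraic {β ν : ℝ} (hβ : 0 < β) (hν : ν < 1) :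
    ∃ c : ℝ, 0 < c ∧ Tendsto (fun n : ℕ => scale (fun k : ℕ => ((k : ℝ) + 1) ^ (-ν)) β n /
      (n : ℝ) ^ (1 + β * (1 - ν))) atTop (𝓝 c) := by
  have hν' : 0 < 1 - ν := by linarith
  have hH : Tendsto (fun n : ℕ => (∑ i ∈ Finset.range n, ((i : ℝ) + 1) ^ (-ν)) /
      (n : ℝ) ^ (-ν + 1)) atTop (𝓝 (1 / (-ν + 1))) := by
    refine tendsto_sum_range_div_rpow (by linarith) (tendsto_const_nhds.congr fun i => ?_)
    exact (div_self (Real.rpow_pos_of_pos (by positivity) _).ne').symm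
  rw [show -ν + 1 = 1 - ν by ring] at hH
  have hH' := ((tendsto_add_atTop_iff_nat 1).2 hH).rpow_const (p := β)
    (Or.inl (one_div_pos.2 hν').ne')
  refine ⟨(1 / (1 - ν)) ^ β / (β * (1 - ν) + 1), by positivity, ?_⟩
  simp only [scale_eq_sum_range_reflect]
  rw [add_comm 1]
  refine tendsto_sum_range_div_rpow (by nlinarith) (hH'.congr fun i => ?_)
  rw [Real.div_rpow (Finset.sum_nonneg fun _ _ => by positivity) (by positivity),
    ← Real.rpow_mul (by positivity), mul_comm β]
  push_cast
  rfl

end AlgebraicKernel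

/-! ### Reduction to weighted sums and uniformity in the level -/

section Uniform

variable {Ω : Type*}

/-- Passing from `n` to `n + 1` adds `m (n - j)` to the weight of `X j`; the new innovation starts
from an empty sum. -/
lemma partialSum_eq_weighted_sum (m : ℕ → ℝ) (X : ℕ → Ω → ℝ) (n : ℕ) (ω : Ω) :
    partialSum m X n ω =
      ∑ j ∈ Finset.range n, (∑ i ∈ Finset.range (n - j), m i) * X j ω := by
  induction n with
  | zero => simp [partialSum]
  | succ n ih =>
    have h1 : ∑ j ∈ Finset.range (n + 1), (∑ i ∈ Finset.range (n + 1 - j), m i) * X j ω =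
        ∑ j ∈ Finset.range (n + 1), ((∑ i ∈ Finset.range (n - j), m i) * X j ω +
          m (n - j) * X j ω) := by
      refine Finset.sum_congr rfl fun j hj => ?_
      rw [Finset.mem_range] at hj
      rw [show n + 1 - j = n - j + 1 by omega, Finset.sum_range_succ, add_mul]
    rw [h1, Finset.sum_add_distrib, Finset.sum_range_succ, Nat.sub_self, Finset.range_zero,
      Finset.sum_empty, zero_mul, add_zero, ← ih, partialSum, Finset.sum_range_succ]
    rfl

variable [MeasurableSpace Ω] {P : Measure Ω} {X : ℕ → Ω → ℝ} {β : ℝ}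

lemma centering_eq_weighted_sum (hident : ∀ j, IdentDistrib (X j) (X 0) P P)
    (hint : ¬ β < 1 → Integrable (X 0) P) (m : ℕ → ℝ) (n : ℕ) :
    centering P m X β n =
      ∑ j ∈ Finset.range n, (∑ i ∈ Finset.range (n - j), m i) * innovationMean P X β := by
  unfold centering innovationMean
  split_ifs with h
  · simp
  · simp only [partialSum_eq_weighted_sum]
    rw [integral_finsetSum _ fun j _ => ((hident j).integrable_iff.2 (hint h)).const_mul _]
    refine Finset.sum_congr rfl fun j _ => ?_
    rw [integral_const_mul, (hident j).integral_eq]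

theorem uniform_large_deviation [IsProbabilityMeasure P] (hβ0 : 0 < β) (hβ2 : β < 2) (hβ1 : β ≠ 1)
    (hindep : iIndepFun X P) (hident : ∀ j, IdentDistrib (X j) (X 0) P P)
    (hnonneg : ∀ᵐ ω ∂P, 0 ≤ X 0 ω) {c : ℝ} (hc0 : 0 < c)
    (hc : Tendsto (fun x : ℝ => x ^ β * (P.map (X 0)).real (Set.Ioi x)) atTop (𝓝 c))
    {m : ℕ → ℝ} (hm0 : ∀ i, 0 < m i) {x : ℕ → ℝ} (hx : Tendsto x atTop atTop)
    (hL : Tendsto (fun n => scale m β n * P.real {ω | x n < X 0 ω}) atTop (𝓝 0))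
    {ε : ℝ} (hε : 0 < ε) :
    ∀ᶠ n in atTop, ∀ y ≥ x n,
      |P.real {ω | y < partialSum m X n ω - centering P m X β n} /
        (scale m β n * P.real {ω | y < X 0 ω}) - 1| ≤ ε := by
  have hm : AEMeasurable (X 0) P := (hident 0).aemeasurable_fst
  have hprob : IsProbabilityMeasure (P.map (X 0)) := Measure.isProbabilityMeasure_map hm
  have htail : ∀ y, P.real {ω | y < X 0 ω} = (P.map (X 0)).real (Set.Ioi y) := fun y =>
    (map_measureReal_apply_of_aemeasurable hm measurableSet_Ioi).symm
  have hint : ¬ β < 1 → Integrable (X 0) P := by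
    intro h
    obtain ⟨C, hC0, hC⟩ := exists_tail_le_rpow hβ0 hc
    have := integrable_id_of_tail_le ((ae_map_iff hm measurableSet_Ici).2 hnonneg)
      (lt_of_le_of_ne (not_lt.1 h) hβ1.symm) hC0.le hC
    exact this.comp_aemeasurable hm
  simp only [htail] at hL ⊢
  set F : ℝ → ℝ := fun y => (P.map (X 0)).real (Set.Ioi y)
  -- The bound `c / 2` keeps `z ^ β F(z) ≥ c / 2`; the bound `ε c / 4` lets two errors of size `e`
  -- fit into `ε (c / 2)`.
  set e := min (ε * c / 4) (c / 2) with he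
  have he0 : 0 < e := by positivity
  obtain ⟨δ, hδ, hcore⟩ := weighted_sum_large_deviation hβ0 hβ2 hβ1 hindep hident hnonneg hc he0
  obtain ⟨N, hN⟩ := eventually_atTop.1 (Metric.tendsto_nhds.1 hc e he0)
  filter_upwards [hx.eventually_ge_atTop (max N 1), eventually_ge_atTop 1,
    hL.eventually_le_const (show 0 < δ * (c / 2) by positivity)] with n hxn hn1 hLn y hy
  have hnear : ∀ z ≥ x n, 0 < z ∧ |z ^ β * F z - c| ≤ e ∧ c / 2 ≤ z ^ β * F z := by
    intro z hz
    have h1 := (hN z ((le_max_left _ _).trans (hxn.trans hz))).le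
    rw [Real.dist_eq] at h1
    refine ⟨lt_of_lt_of_le one_pos ((le_max_right _ _).trans (hxn.trans hz)), h1, ?_⟩
    have := (abs_le.1 h1).1
    linarith [min_le_right (ε * c / 4) (c / 2)]
  obtain ⟨hx0, -, hxF⟩ := hnear (x n) le_rfl
  obtain ⟨hy0, hyF, hyF'⟩ := hnear y hy
  have hyβ : 0 < y ^ β := Real.rpow_pos_of_pos hy0 β
  have hxβ : 0 < x n ^ β := Real.rpow_pos_of_pos hx0 β
  have hw : ∀ j ∈ Finset.range n, 0 < ∑ i ∈ Finset.range (n - j), m i := fun j hj =>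
    Finset.sum_pos (fun i _ => hm0 i)
      (Finset.nonempty_range_iff.2 (Nat.sub_pos_of_lt (Finset.mem_range.1 hj)).ne')
  have hLpos : 0 < scale m β n := by
    rw [scale_eq_sum_range]
    exact Finset.sum_pos (fun j hj => Real.rpow_pos_of_pos (hw j hj) β)
      (Finset.nonempty_range_iff.2 (by omega))
  set v : ℕ → ℝ := fun j => (∑ i ∈ Finset.range (n - j), m i) / y with hvdef
  have hv : ∀ j ∈ Finset.range n, 0 < v j := fun j hj => div_pos (hw j hj) hy0
  have hV : ∑ j ∈ Finset.range n, v j ^ β = scale m β n / y ^ β := by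
    rw [scale_eq_sum_range, Finset.sum_div]
    exact Finset.sum_congr rfl fun j hj => Real.div_rpow (hw j hj).le hy0.le β
  -- Uniformity enters here: the ratio decreases in `y`, and at `x n` it equals `L_n F(x_n)` divided
  -- by `x_n ^ β F(x_n) ≥ c / 2`.
  have hVδ : scale m β n / y ^ β ≤ δ := by
    calc scale m β n / y ^ β ≤ scale m β n / x n ^ β := by gcongr
      _ ≤ δ := by
        rw [div_le_iff₀ hxβ]
        have h1 : scale m β n * (c / 2) ≤ scale m β n * (x n ^ β * F (x n)) := by gcongr
        have h2 : x n ^ β * (scale m β n * F (x n)) ≤ x n ^ β * (δ * (c / 2)) := by gcongr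
        have h3 : scale m β n * (c / 2) ≤ δ * x n ^ β * (c / 2) := by linarith
        exact le_of_mul_le_mul_right h3 (by positivity)
  have hmain := hcore (Finset.range n) v hv (hV.trans_le hVδ)
  have hset : {ω | 1 < ∑ j ∈ Finset.range n, v j * X j ω -
      ∑ j ∈ Finset.range n, v j * innovationMean P X β} =
      {ω | y < partialSum m X n ω - centering P m X β n} := by
    ext ω
    rw [Set.mem_ofPred_eq, Set.mem_ofPred_eq, partialSum_eq_weighted_sum,
      centering_eq_weighted_sum hident hint]
    simp only [hvdef, div_mul_eq_mul_div, ← Finset.sum_div, ← sub_div]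
    rw [one_lt_div hy0]
  rw [hset, hV] at hmain
  set p := P.real {ω | y < partialSum m X n ω - centering P m X β n}
  set V := scale m β n / y ^ β with hVdef
  have hV0 : 0 < V := div_pos hLpos hyβ
  have hLF : scale m β n * F y = V * (y ^ β * F y) := by
    rw [hVdef]; field_simp
  show |p / (scale m β n * F y) - 1| ≤ ε
  rw [hLF]
  have hden : 0 < V * (y ^ β * F y) := mul_pos hV0 (by linarith)
  rw [div_sub_one hden.ne', abs_div, abs_of_pos hden, div_le_iff₀ hden]
  have h1 : |p - V * (y ^ β * F y)| ≤ e * V + V * e := by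
    refine (abs_sub_le p (c * V) _).trans (add_le_add hmain ?_)
    rw [mul_comm c V, ← mul_sub, abs_mul, abs_of_pos hV0, abs_sub_comm]
    gcongr
  refine h1.trans ?_
  calc e * V + V * e = V * (2 * e) := by ring
    _ ≤ V * (ε * (c / 2)) := by
      refine mul_le_mul_of_nonneg_left ?_ hV0.le
      linarith [min_le_left (ε * c / 4) (c / 2)]
    _ ≤ V * (ε * (y ^ β * F y)) := by gcongr
    _ = _ := by ring

lemma tendsto_iSup_ofReal_zero {ι : Type*} {l : Filter ι} {x : ι → ℝ} {f : ι → ℝ → ℝ}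
    (h : ∀ ε > 0, ∀ᶠ n in l, ∀ y ≥ x n, f n y ≤ ε) :
    Tendsto (fun n => ⨆ y ∈ Set.Ici (x n), ENNReal.ofReal (f n y)) l (𝓝 0) := by
  rw [ENNReal.tendsto_nhds_zero]
  intro ε hε
  obtain ⟨r, -, hr0, hrε⟩ := ENNReal.lt_iff_exists_real_btwn.1 hε
  filter_upwards [h r (ENNReal.ofReal_pos.1 hr0)] with n hn
  exact iSup₂_le fun y hy => (ENNReal.ofReal_le_ofReal (hn y hy)).trans hrε.le

end Uniform

end MemoryWalk

end

/-- Precise large deviations for sums with a memory kernel, uniformly in `x ≥ x_n`, together with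
the growth of `L_n` for the algebraic kernels `m_k = (k + 1) ^ (-ν)`, `0 < ν < 1`. -/
theorem mainTheorem4 {Ω : Type*} [MeasurableSpace Ω] (P : Measure Ω) [IsProbabilityMeasure P]
    (β : ℝ) (hβ : β ∈ Set.Ioo (0 : ℝ) 2 \ {1})
    (X : ℕ → Ω → ℝ)
    (hindep : iIndepFun X P)
    (hident : ∀ j, IdentDistrib (X j) (X 0) P P)
    (hnonneg : ∀ᵐ ω ∂P, 0 ≤ X 0 ω)
    (hRV : MemoryWalk.RegularlyVaryingTail P (X 0) β)
    (hNDA : MemoryWalk.InNormalDomainOfAttraction P X β) :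
    (∀ m : ℕ → ℝ, m 0 = 1 → (∀ i, 0 < m i) →
      ∀ x : ℕ → ℝ, Tendsto x atTop atTop →
        Tendsto (fun n => MemoryWalk.scale m β n * P.real {ω | x n < X 0 ω}) atTop (𝓝 0) →
        Tendsto
          (fun n => ⨆ y ∈ Set.Ici (x n), ENNReal.ofReal
            |P.real {ω | y < MemoryWalk.partialSum m X n ω - MemoryWalk.centering P m X β n} /
                (MemoryWalk.scale m β n * P.real {ω | y < X 0 ω}) - 1|)
          atTop (𝓝 0)) ∧
    (∀ ν : ℝ, 0 < ν → ν < 1 → ∃ c : ℝ, 0 < c ∧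
      Tendsto
        (fun n : ℕ => MemoryWalk.scale (fun k : ℕ => ((k : ℝ) + 1) ^ (-ν)) β n /
          (n : ℝ) ^ (1 + β * (1 - ν)))
        atTop (𝓝 c)) := by
  obtain ⟨⟨hβ0, hβ2⟩, hβ1⟩ := hβ
  refine ⟨fun m _ hm x hx hL => ?_, fun ν _ hν => MemoryWalk.exists_tendsto_scale_algebraic hβ0 hν⟩
  have hX : AEMeasurable (X 0) P := (hident 0).aemeasurable_fst
  have hprob : IsProbabilityMeasure (P.map (X 0)) := Measure.isProbabilityMeasure_map hX
  have hlaw : MemoryWalk.RegularlyVaryingLaw (P.map (X 0)) β := by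
    intro Λ hΛ
    simp only [map_measureReal_apply_of_aemeasurable hX measurableSet_Ioi]
    exact hRV Λ hΛ
  obtain ⟨τ, hτ, hφ⟩ := hNDA.tendsto_norm_charFun hindep hident
  obtain ⟨c, hc0, hc⟩ := hlaw.exists_tendsto_rpow_mul_tail hβ0 hβ2
    ((ae_map_iff hX measurableSet_Ici).2 hnonneg) hτ hφ
  exact MemoryWalk.tendsto_iSup_ofReal_zero fun ε hε =>
    MemoryWalk.uniform_large_deviation hβ0 hβ2 hβ1 hindep hident hnonneg hc0 hc hm hx hL hε
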